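/- Composition is written in diagrammatic order: $f\cdot g$ is $f$ followed by $g$. Let $\mathcal C$ be a semi-abelian category (pointed, Barr exact, protomodular, with finite coproducts) satisfying the condition "Huq = Smith": two equivalence relations on the same object commute in the sense of Smith as soon as their normalizations (zero classes) commute in the sense of Huq. For objects $B,X$ let $j\colon B\flat X\to B+X$ be the kernel of $[1,0]\colon B+X\to B$. An internal action of $B$ on $X$ is an algebra $\xi\colon B\flat X\to X$ for the monad $B\flat(-)$, and $\chi_X=j\cdot[1,1]\colon X\flat X\to X$ is the conjugation action. A crossed module $\mathbb G$ in $\mathcal C$ is a morphism $\partial\colon G\to G_0$ with an action $\xi\colon G_0\flat G\to G$ such that $(\partial\flat 1)\cdot\xi=\chi_G$ and $\xi\cdot\partial=(1\flat\partial)\cdot\chi_{G_0}$. Its associated groupoid has object of arrows $G_1=G\rtimes_\xi G_0$, codomain $c\colon G_1\to G_0$ the projection, domain $d=[\partial,1]$ and inversion $i$; let $g\colon G\to G_1$ be the kernel of $c$, and $g^\bullet=g\cdot i$, which is a kernel of $d$. A butterfly $E\colon\mathbb H\to\mathbb G$ between crossed modules consists of an object $E$ and morphisms $\kappa\colon H\to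 E$, $\rho\colon E\to G_0$, $\iota\colon G\to E$, $\sigma\colon E\to H_0$ with $\kappa\cdot\sigma=\partial$ and $\iota\cdot\rho=\partial$, such that (i) $\kappa\cdot\rho=0$; (ii) $(\iota,\sigma)$ is an extension, that is, $\iota$ is a kernel of $\sigma$ and $\sigma$ is a cokernel of $\iota$; (iii) $(\sigma\flat 1)\cdot\xi\cdot\kappa=(1\flat\kappa)\cdot\chi_E$ on $E\flat H$; (iv) $(\rho\flat 1)\cdot\xi\cdot\iota=(1\flat\iota)\cdot\chi_E$ on $E\flat G$. A morphism of butterflies $E\to E'$ is a morphism $f\colon E\to E'$ in $\mathcal C$ with $\kappa\cdot f=\kappa'$, $f\cdot\rho'=\rho$, $\iota\cdot f=\iota'$ and $f\cdot\sigma'=\sigma$. The bicategory $\mathcal B(\mathcal C)$ has crossed modules in $\mathcal C$ as objects, butterflies as 1-cells and morphisms of butterflies as 2-cells. The composite of $E\colon\mathbb H\to\mathbb G$ and $E'\colon\mathbb G\to\mathbb K$ is the cokernel $q\colon E\times_{\rho,\sigma'}E'\to Q$ of $\langle\iota,\kappa'\rangle\colon G\to E\times_{\rho,\sigma'}E'$,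 with the morphisms $\langle\kappa,0\rangle\cdot q\colon H\to Q$, $\langle 0,\iota'\rangle\cdot q\colon K\to Q$, and the morphisms $Q\to H_0$ and $Q\to K_0$ induced by $\sigma$ and $\rho'$. The identity butterfly on $\mathbb G$ is $G_1$ with $\kappa=g^\bullet$, $\rho=d$, $\iota=g$, $\sigma=c$. The constraints are the canonical ones: on generalized elements, the associator is $((x,y),z)\mapsto(x,(y,z))$, and with $e\colon G_0\to G_1$ the identity-arrow morphism (and likewise for $\mathbb H$) the inverse unitors are $x\mapsto(\sigma(x)\cdot e,\,x)$ and $x\mapsto(x,\,\rho(x)\cdot e)$, where $(x,y)$ denotes the class of a generalized element of the pullback. A butterfly $E=(E,\kappa,\rho,\iota,\sigma)\colon\mathbb H\to\mathbb G$ is called flippable if its other diagonal is an extension as well, that is, $\kappa$ is a kernel of $\rho$ and $\rho$ is a cokernel of $\kappa$. **Proposition.** Every flippable butterfly $E\colon\mathbb H\to\mathbb G$ is an equivalence in the bicategory $\mathcal B(\mathcal C)$. A quasi-inverse is the butterfly $E^*\colon\mathbb G\to\mathbb H$ obtained by twisting the wings of $E$, that is, $E^*=(E,\iota,\sigma,\kappa,\rho)$: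 the same object $E$, with $\kappa^*=\iota$, $\rho^*=\sigma$, $\iota^*=\kappa$ and $\sigma^*=\rho$. -/

import Mathlib

open CategoryTheory CategoryTheory.Limits

universe v u

namespace SemiAb

section Basic

variable {C : Type u} [Category.{v} C] [HasZeroMorphisms C]

/-- `k` is a kernel of `p`. -/
def IsKernel {K A B : C} (k : K ⟶ A) (p : A ⟶ B) : Prop :=
  ∃ w : k ≫ p = 0, Nonempty (IsLimit (KernelFork.ofι k w))

/-- `q` is a cokernel of `f`. -/
def IsCokernel {A B Q : C} (f : A ⟶ B) (q : B ⟶ Q) : Prop :=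
  ∃ w : f ≫ q = 0, Nonempty (IsColimit (CokernelCofork.ofπ q w))

/-- `(i, p)` is an extension: `i` is a kernel of `p` and `p` is a cokernel of `i`. -/
def IsExtension {K A B : C} (i : K ⟶ A) (p : A ⟶ B) : Prop :=
  IsKernel i p ∧ IsCokernel i p

end Basic

/-- Semi-abelian categories: pointed, with finite coproducts, Barr exact (regular, and every
internal equivalence relation is a kernel pair) and protomodular (the split short five lemma
holds). -/
class SemiAbelian (C : Type u) [Category.{v} C] [HasZeroMorphisms C] : Prop where
  regular : Regular C
  hasZeroObject : HasZeroObject C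
  hasFiniteCoproducts : HasFiniteCoproducts C
  effective : ∀ {R X : C} (r₁ r₂ : R ⟶ X), IsEquivalenceRelation r₁ r₂ →
    ∃ (Y : C) (f : X ⟶ Y), IsKernelPair f r₁ r₂
  split_short_five : ∀ {K A B K' A' B' : C} (k : K ⟶ A) (p : A ⟶ B) (s : B ⟶ A)
    (k' : K' ⟶ A') (p' : A' ⟶ B') (s' : B' ⟶ A') (h : K ⟶ K') (f : A ⟶ A') (g : B ⟶ B'),
    IsKernel k p → IsKernel k' p' → s ≫ p = 𝟙 B → s' ≫ p' = 𝟙 B' →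
    k ≫ f = h ≫ k' → p ≫ g = f ≫ p' → s ≫ f = g ≫ s' → IsIso h → IsIso g → IsIso f

attribute [instance] SemiAbelian.regular SemiAbelian.hasZeroObject SemiAbelian.hasFiniteCoproducts

/-- Two morphisms with the same codomain cooperate (commute in the sense of Huq). -/
def Cooperate {C : Type u} [Category.{v} C] [HasZeroMorphisms C] [HasFiniteProducts C]
    {G H E : C} (g : G ⟶ E) (h : H ⟶ E) : Prop :=
  ∃ φ : G ⨯ H ⟶ E, prod.lift (𝟙 G) 0 ≫ φ = g ∧ prod.lift 0 (𝟙 H) ≫ φ = h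

/-- Two equivalence relations on the same object commute in the sense of Smith: there is a
morphism `Φ`, thought of as a partial Mal'tsev operation `(x, y, z) ↦ Φ (x, y, z)` defined when
`x R y` and `y S z`, such that `Φ (x, y, y) = x` and `Φ (y, y, z) = z`. -/
def SmithCommute {C : Type u} [Category.{v} C] [HasPullbacks C] {R S X : C}
    {r₁ r₂ : R ⟶ X} {s₁ s₂ : S ⟶ X} (hR : EquivalenceRelation r₁ r₂)
    (hS : EquivalenceRelation s₁ s₂) : Prop :=
  ∃ Φ : pullback r₂ s₁ ⟶ X,
    pullback.lift (𝟙 R) (r₂ ≫ hS.r) (by simp) ≫ Φ = r₁ ∧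
    pullback.lift (s₁ ≫ hR.r) (𝟙 S) (by simp) ≫ Φ = s₂

/-- The condition "Huq = Smith": two equivalence relations on the same object commute (in the
sense of Smith) as soon as their normalizations, i.e. their zero classes, cooperate. -/
class HuqSmith (C : Type u) [Category.{v} C] [HasZeroMorphisms C] [SemiAbelian C] : Prop where
  smith_of_huq : ∀ {R S X : C} {r₁ r₂ : R ⟶ X} {s₁ s₂ : S ⟶ X} (hR : EquivalenceRelation r₁ r₂)
    (hS : EquivalenceRelation s₁ s₂),
    Cooperate (kernel.ι r₁ ≫ r₂) (kernel.ι s₁ ≫ s₂) → SmithCommute hR hS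

section Theory

attribute [local simp] pullback.lift_fst pullback.lift_fst_assoc pullback.lift_snd
  pullback.lift_snd_assoc coprod.inl_desc coprod.inl_desc_assoc coprod.inr_desc
  coprod.inr_desc_assoc prod.lift_fst prod.lift_fst_assoc prod.lift_snd prod.lift_snd_assoc

set_option linter.unusedSectionVars false

variable {C : Type u} [Category.{v} C] [HasZeroMorphisms C]

section
variable {K A B : C} {k : K ⟶ A} {p : A ⟶ B}

lemma IsKernel.w (h : IsKernel k p) : k ≫ p = 0 := h.1

lemma IsKernel.mono (h : IsKernel k p) : Mono k := by
  obtain ⟨w, ⟨hl⟩⟩ := h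
  exact mono_of_isLimit_fork hl

lemma IsKernel.fac (h : IsKernel k p) {T : C} (x : T ⟶ A) (hx : x ≫ p = 0) :
    ∃ y : T ⟶ K, y ≫ k = x := by
  obtain ⟨w, ⟨hl⟩⟩ := h
  exact ⟨_, (KernelFork.IsLimit.lift' hl x hx).2⟩

lemma IsKernel.mk' (w : k ≫ p = 0) [Mono k]
    (h : ∀ {T : C} (x : T ⟶ A), x ≫ p = 0 → ∃ y : T ⟶ K, y ≫ k = x) : IsKernel k p := by
  refine ⟨w, ⟨KernelFork.IsLimit.ofι' k w fun x hx => ⟨(h x hx).choose, (h x hx).choose_spec⟩⟩⟩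

lemma isKernel_kernel (f : A ⟶ B) [HasKernel f] : IsKernel (kernel.ι f) f :=
  IsKernel.mk' (kernel.condition f) fun x hx => ⟨kernel.lift f x hx, kernel.lift_ι _ _ _⟩

lemma IsCokernel.mk' {Q : C} {q : A ⟶ Q} (w : k ≫ q = 0) [Epi q]
    (h : ∀ {T : C} (x : A ⟶ T), k ≫ x = 0 → ∃ y : Q ⟶ T, q ≫ y = x) : IsCokernel k q := by
  refine ⟨w, ⟨CokernelCofork.IsColimit.ofπ' q w
    fun x hx => ⟨(h x hx).choose, (h x hx).choose_spec⟩⟩⟩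

lemma IsCokernel.w {Q : C} {q : A ⟶ Q} (h : IsCokernel k q) : k ≫ q = 0 := h.1

lemma IsCokernel.epi {Q : C} {q : A ⟶ Q} (h : IsCokernel k q) : Epi q := by
  obtain ⟨w, ⟨hl⟩⟩ := h
  exact epi_of_isColimit_cofork hl

lemma IsCokernel.fac {Q T : C} {q : A ⟶ Q} (h : IsCokernel k q) (x : A ⟶ T) (hx : k ≫ x = 0) :
    ∃ y : Q ⟶ T, q ≫ y = x := by
  obtain ⟨w, ⟨hl⟩⟩ := h
  exact ⟨_, (CokernelCofork.IsColimit.desc' hl x hx).2⟩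

lemma IsCokernel.isRegularEpi {Q : C} {q : A ⟶ Q} (h : IsCokernel k q) : IsRegularEpi q := by
  obtain ⟨w, ⟨hl⟩⟩ := h
  exact ⟨⟨Cofork.IsColimit.regularEpi hl⟩⟩
end

variable [SemiAbelian C]

/-- A monomorphism through which the section and the kernel of a point factor is invertible. -/
lemma point_iso {K A B M : C} {k : K ⟶ A} {p : A ⟶ B} {s : B ⟶ A} (hk : IsKernel k p)
    (hs : s ≫ p = 𝟙 B) (m : M ⟶ A) [Mono m] (k' : K ⟶ M) (hk' : k' ≫ m = k)
    (s' : B ⟶ M) (hs' : s' ≫ m = s) : IsIso m := by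
  have : Mono k := hk.mono
  have : Mono k' := mono_of_mono_fac hk'
  have hkm : IsKernel k' (m ≫ p) := by
    refine IsKernel.mk' (by rw [← Category.assoc, hk', hk.w]) fun x hx => ?_
    obtain ⟨y, hy⟩ := hk.fac (x ≫ m) (by simpa using hx)
    exact ⟨y, by rw [← cancel_mono m, ← hy, Category.assoc, hk']⟩
  exact SemiAbelian.split_short_five k' (m ≫ p) s' k p s (𝟙 K) m (𝟙 B) hkm hk
    (by rw [← Category.assoc, hs', hs]) hs (by simpa using hk') (by simp) (by simpa using hs')
    inferInstance inferInstance

lemma point_ext {K A B Z : C} {k : K ⟶ A} {p : A ⟶ B} {s : B ⟶ A} (hk : IsKernel k p)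
    (hs : s ≫ p = 𝟙 B) (f g : A ⟶ Z) (h₁ : k ≫ f = k ≫ g) (h₂ : s ≫ f = s ≫ g) : f = g := by
  have := point_iso hk hs (equalizer.ι f g) (equalizer.lift k h₁) (by simp)
    (equalizer.lift s h₂) (by simp)
  exact eq_of_epi_equalizer

open ZeroObject in
lemma mono_of_trivial_kernel {A B : C} (f : A ⟶ B)
    (h : ∀ {T : C} (t : T ⟶ A), t ≫ f = 0 → t = 0) : Mono f := by
  have hk : IsKernel (0 : (0 : C) ⟶ pullback f f) (pullback.fst f f) := by
    refine IsKernel.mk' (by simp) fun x hx => ⟨0, ?_⟩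
    have : x ≫ pullback.snd f f = 0 := h _ (by
      rw [Category.assoc, ← pullback.condition, ← Category.assoc, hx, zero_comp])
    apply pullback.hom_ext <;> simp [*]
  have e := point_ext hk (s := pullback.lift (𝟙 A) (𝟙 A) rfl) (by simp)
    (pullback.fst f f) (pullback.snd f f) (by simp) (by simp)
  exact ⟨fun a b hab => by
    have := congrArg (pullback.lift a b hab ≫ ·) e
    simpa using this⟩

lemma covering {A Q T : C} (q : A ⟶ Q) [IsRegularEpi q] (x : T ⟶ Q) :
    ∃ (T' : C) (c : T' ⟶ T) (_ : IsRegularEpi c) (y : T' ⟶ A), c ≫ x = y ≫ q :=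
  ⟨pullback x q, pullback.fst x q, inferInstance, pullback.snd x q, pullback.condition⟩

lemma isRegularEpi_of_extremal {A B : C} (f : A ⟶ B)
    (h : ∀ {M : C} (g : A ⟶ M) (m : M ⟶ B) [Mono m], g ≫ m = f → IsIso m) : IsRegularEpi f := by
  have : ExtremalEpi f := ExtremalEpi.mk_of_hasEqualizers f fun Z p i hi _ => h p i hi
  infer_instance

lemma isIso_of_regularEpi_fac {A B M : C} (f : A ⟶ B) [IsRegularEpi f] (g : A ⟶ M) (m : M ⟶ B)
    [Mono m] (h : g ≫ m = f) : IsIso m :=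
  ExtremalEpi.isIso f g m h

lemma isRegularEpi_comp {A B D : C} (f : A ⟶ B) (g : B ⟶ D) [IsRegularEpi f] [IsRegularEpi g] :
    IsRegularEpi (f ≫ g) := by
  have : StrongEpi (f ≫ g) := strongEpi_comp f g
  infer_instance

lemma isRegularEpi_of_comp {A B D : C} (f : A ⟶ B) (g : B ⟶ D) (h : IsRegularEpi (f ≫ g)) :
    IsRegularEpi g :=
  isRegularEpi_of_extremal g fun a m _ ha =>
    isIso_of_regularEpi_fac (f ≫ g) (f ≫ a) m (by simp [ha])

/-- If `r` is a regular epimorphism from the total object of a point, then a monomorphism through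
which the restrictions of `r` to the section and to the kernel factor is invertible. -/
lemma point_gen {K A B M L : C} {k : K ⟶ A} {p : A ⟶ B} {s : B ⟶ A} (hk : IsKernel k p)
    (hs : s ≫ p = 𝟙 B) (r : A ⟶ L) [IsRegularEpi r] (m : M ⟶ L) [Mono m]
    (k' : K ⟶ M) (hk' : k' ≫ m = k ≫ r) (s' : B ⟶ M) (hs' : s' ≫ m = s ≫ r) : IsIso m := by
  have := point_iso hk hs (pullback.snd m r) (pullback.lift k' k hk') (by simp)
    (pullback.lift s' s hs') (by simp)
  exact isIso_of_regularEpi_fac r (inv (pullback.snd m r) ≫ pullback.fst m r) m (by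
    rw [Category.assoc, pullback.condition, IsIso.inv_hom_id_assoc])

/-- A regular epimorphism is a cokernel of its kernel. -/
lemma isCokernel_of_regularEpi {K A B : C} {k : K ⟶ A} {f : A ⟶ B} [IsRegularEpi f]
    (hk : IsKernel k f) : IsCokernel k f := by
  refine IsCokernel.mk' hk.w fun {T} x hx => ?_
  have hK : IsKernel (pullback.lift (0 : K ⟶ A) k (by simp [hk.w])) (pullback.fst f f) := by
    have : Mono k := hk.mono
    have : Mono (pullback.lift (0 : K ⟶ A) k (by simp [hk.w]) : K ⟶ pullback f f) :=
      mono_of_mono_fac (pullback.lift_snd (0 : K ⟶ A) k (by simp [hk.w]))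
    refine IsKernel.mk' (by simp) fun y hy => ?_
    obtain ⟨z, hz⟩ := hk.fac (y ≫ pullback.snd f f) (by
      rw [Category.assoc, ← pullback.condition, ← Category.assoc, hy, zero_comp])
    exact ⟨z, by apply pullback.hom_ext <;> simp [*]⟩
  have e := point_ext hK (s := pullback.lift (𝟙 A) (𝟙 A) rfl) (by simp)
    (pullback.fst f f ≫ x) (pullback.snd f f ≫ x) (by simp [hx]) (by simp)
  refine ⟨IsRegularEpi.desc f x ?_, IsRegularEpi.fac _ _ _⟩
  have := congrArg (pullback.lift _ _ (IsRegularEpi.w f) ≫ ·) e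
  simpa using this

lemma isExtension_of_regularEpi {K A B : C} {k : K ⟶ A} {f : A ⟶ B} [IsRegularEpi f]
    (hk : IsKernel k f) : IsExtension k f := ⟨hk, isCokernel_of_regularEpi hk⟩

end Theory

section Flat

attribute [local simp] pullback.lift_fst pullback.lift_fst_assoc pullback.lift_snd
  pullback.lift_snd_assoc coprod.inl_desc coprod.inl_desc_assoc coprod.inr_desc
  coprod.inr_desc_assoc prod.lift_fst prod.lift_fst_assoc prod.lift_snd prod.lift_snd_assoc

set_option linter.unusedSectionVars false

variable {C : Type u} [Category.{v} C] [HasZeroMorphisms C] [SemiAbelian C]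

/-- The object `B ♭ X`, the kernel of `[1, 0] : B + X ⟶ B`. -/
noncomputable def flat (B X : C) : C := kernel (coprod.desc (𝟙 B) (0 : X ⟶ B))

/-- The kernel inclusion `B ♭ X ⟶ B + X`. -/
noncomputable def flatι (B X : C) : flat B X ⟶ B ⨿ X := kernel.ι _

/-- The morphism into `B ♭ X` induced by a morphism into `B + X` killed by `[1, 0]`. -/
noncomputable def flatLift {B X T : C} (t : T ⟶ B ⨿ X) (ht : t ≫ coprod.desc (𝟙 B) 0 = 0) :
    T ⟶ flat B X := kernel.lift _ t ht

lemma isKernel_flatι (B X : C) :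
    IsKernel (flatι B X) (coprod.desc (𝟙 B) (0 : X ⟶ B)) := isKernel_kernel _

instance (B X : C) : Mono (flatι B X) := (isKernel_flatι B X).mono

@[simp]
lemma flatι_comp (B X : C) : flatι B X ≫ coprod.desc (𝟙 B) (0 : X ⟶ B) = 0 :=
  (isKernel_flatι B X).w

@[simp]
lemma flatLift_ι {B X T : C} (t : T ⟶ B ⨿ X) (ht : t ≫ coprod.desc (𝟙 B) 0 = 0) :
    flatLift t ht ≫ flatι B X = t := kernel.lift_ι _ _ _

/-- Functoriality of `♭` in both variables. -/
noncomputable def flatMap {B X B' X' : C} (f : B ⟶ B') (g : X ⟶ X') : flat B X ⟶ flat B' X' :=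
  flatLift (flatι B X ≫ coprod.map f g) (by
    have : coprod.map f g ≫ coprod.desc (𝟙 B') 0 = coprod.desc (𝟙 B) 0 ≫ f := by
      ext <;> simp
    rw [Category.assoc, this, ← Category.assoc, flatι_comp, zero_comp])

@[simp]
lemma flatMap_ι {B X B' X' : C} (f : B ⟶ B') (g : X ⟶ X') :
    flatMap f g ≫ flatι B' X' = flatι B X ≫ coprod.map f g := flatLift_ι _ _

@[simp]
lemma flatMap_ι_assoc {B X B' X' Z : C} (f : B ⟶ B') (g : X ⟶ X') (z : B' ⨿ X' ⟶ Z) :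
    flatMap f g ≫ flatι B' X' ≫ z = flatι B X ≫ coprod.map f g ≫ z := by
  rw [← Category.assoc, flatMap_ι, Category.assoc]

lemma flatMap_comp {B B' B'' : C} (X : C) (f : B ⟶ B') (f' : B' ⟶ B'') :
    flatMap (f ≫ f') (𝟙 X) = flatMap f (𝟙 X) ≫ flatMap f' (𝟙 X) := by
  rw [← cancel_mono (flatι B'' X), Category.assoc, flatMap_ι, flatMap_ι, flatMap_ι_assoc]
  congr 1
  ext <;> simp

/-- The unit `X ⟶ B ♭ X` of the monad `B ♭ (-)`. -/
noncomputable def flatUnit (B X : C) : X ⟶ flat B X := flatLift coprod.inr (by simp)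

@[simp]
lemma flatUnit_ι (B X : C) : flatUnit B X ≫ flatι B X = coprod.inr := flatLift_ι _ _

/-- The multiplication `B ♭ (B ♭ X) ⟶ B ♭ X` of the monad `B ♭ (-)`. -/
noncomputable def flatMul (B X : C) : flat B (flat B X) ⟶ flat B X :=
  flatLift (flatι B (flat B X) ≫ coprod.desc coprod.inl (flatι B X)) (by
    have : coprod.desc coprod.inl (flatι B X) ≫ coprod.desc (𝟙 B) 0 = coprod.desc (𝟙 B) 0 := by
      ext <;> simp
    rw [Category.assoc, this, flatι_comp])

@[simp]
lemma flatMul_ι (B X : C) :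
    flatMul B X ≫ flatι B X = flatι B (flat B X) ≫ coprod.desc coprod.inl (flatι B X) :=
  flatLift_ι _ _

/-- The canonical conjugation action `χ : X ♭ X ⟶ X`. -/
noncomputable def conj (X : C) : flat X X ⟶ X := flatι X X ≫ coprod.desc (𝟙 X) (𝟙 X)

lemma flatMap_conj_eq {A G E : C} (f : A ⟶ E) (g : G ⟶ E) :
    flatMap f g ≫ conj E = flatι A G ≫ coprod.desc f g := by
  simp only [conj, ← Category.assoc, flatMap_ι]
  simp only [Category.assoc]
  congr 1
  ext <;> simp

/-- Descent of factorizations through monomorphisms along regular epimorphisms. -/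
lemma fac_of_cover {T T' M A : C} (c : T' ⟶ T) [IsRegularEpi c] (x : T ⟶ A) (m : M ⟶ A) [Mono m]
    (z : T' ⟶ M) (h : c ≫ x = z ≫ m) : ∃ w : T ⟶ M, w ≫ m = x := by
  have sq : CommSq z c m x := ⟨h.symm⟩
  exact ⟨sq.lift, sq.fac_right⟩

lemma isKernel_pullback_snd {K A B D : C} {k : K ⟶ A} {f : A ⟶ D} (g : B ⟶ D)
    (hk : IsKernel k f) :
    IsKernel (pullback.lift k (0 : K ⟶ B) (by simp [hk.w])) (pullback.snd f g) := by
  have : Mono k := hk.mono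
  have : Mono (pullback.lift k (0 : K ⟶ B) (by simp [hk.w]) : K ⟶ pullback f g) :=
    mono_of_mono_fac (pullback.lift_fst k (0 : K ⟶ B) (by simp [hk.w]))
  refine IsKernel.mk' (by simp) fun y hy => ?_
  obtain ⟨z, hz⟩ := hk.fac (y ≫ pullback.fst f g) (by
    rw [Category.assoc, pullback.condition, ← Category.assoc, hy, zero_comp])
  exact ⟨z, by apply pullback.hom_ext <;> simp [*]⟩

lemma isKernel_pullback_fst {K A B D : C} {k : K ⟶ B} (f : A ⟶ D) {g : B ⟶ D}
    (hk : IsKernel k g) :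
    IsKernel (pullback.lift (0 : K ⟶ A) k (by simp [hk.w])) (pullback.fst f g) := by
  have : Mono k := hk.mono
  have : Mono (pullback.lift (0 : K ⟶ A) k (by simp [hk.w]) : K ⟶ pullback f g) :=
    mono_of_mono_fac (pullback.lift_snd (0 : K ⟶ A) k (by simp [hk.w]))
  refine IsKernel.mk' (by simp) fun y hy => ?_
  obtain ⟨z, hz⟩ := hk.fac (y ≫ pullback.snd f g) (by
    rw [Category.assoc, ← pullback.condition, ← Category.assoc, hy, zero_comp])
  exact ⟨z, by apply pullback.hom_ext <;> simp [*]⟩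

/-- Every relation is difunctional (the Mal'tsev property). -/
lemma difunctional {R X : C} (r₁ r₂ : R ⟶ X) [JointlyMono₂ r₁ r₂] {T : C} (a b c : T ⟶ R)
    (h₁ : a ≫ r₂ = b ≫ r₂) (h₂ : b ≫ r₁ = c ≫ r₁) :
    ∃ d : T ⟶ R, d ≫ r₁ = a ≫ r₁ ∧ d ≫ r₂ = c ≫ r₂ := by
  let f : pullback r₁ r₁ ⟶ X := pullback.fst r₁ r₁ ≫ r₂
  let P := pullback r₂ f
  let u : P ⟶ X ⨯ X := prod.lift (pullback.fst r₂ f ≫ r₁) (pullback.snd r₂ f ≫ pullback.snd r₁ r₁ ≫ r₂)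
  have hm : Mono (prod.lift r₁ r₂) := ⟨fun x y hxy =>
    JointlyMono₂.right_cancellation (p₁ := r₁) (p₂ := r₂) x y
      (by simpa using congrArg (· ≫ prod.fst) hxy) (by simpa using congrArg (· ≫ prod.snd) hxy)⟩
  have hk := isKernel_pullback_snd f (isKernel_kernel r₂)
  have : IsIso (pullback.snd (prod.lift r₁ r₂) u) := point_iso hk
    (s := pullback.lift (pullback.fst r₁ r₁) (𝟙 _) (by simp [f])) (by simp) _
    (pullback.lift (kernel.ι r₂) (pullback.lift (kernel.ι r₂) 0 (by simp)) (by
      ext <;> simp [u])) (by simp)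
    (pullback.lift (pullback.snd r₁ r₁) (pullback.lift (pullback.fst r₁ r₁) (𝟙 _) (by simp [f]))
      (by ext <;> simp [u, pullback.condition])) (by simp)
  let t : T ⟶ P := pullback.lift a (pullback.lift b c h₂) (by simp [f, h₁])
  refine ⟨t ≫ inv (pullback.snd (prod.lift r₁ r₂) u) ≫ pullback.fst _ _, ?_⟩
  have e : (t ≫ inv (pullback.snd (prod.lift r₁ r₂) u) ≫ pullback.fst _ _) ≫ prod.lift r₁ r₂
      = t ≫ u := by
    rw [Category.assoc, Category.assoc, pullback.condition, IsIso.inv_hom_id_assoc]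
  have e1 := congrArg (· ≫ prod.fst) e
  have e2 := congrArg (· ≫ prod.snd) e
  constructor
  · simpa [u, t] using e1
  · simpa [u, t] using e2

lemma equivalence_of_reflexive {R X : C} (r₁ r₂ : R ⟶ X) [JointlyMono₂ r₁ r₂] (e : X ⟶ R)
    (h₁ : e ≫ r₁ = 𝟙 X) (h₂ : e ≫ r₂ = 𝟙 X) : IsEquivalenceRelation r₁ r₂ := by
  obtain ⟨s, hs₁, hs₂⟩ := difunctional r₁ r₂ (r₂ ≫ e) (𝟙 R) (r₁ ≫ e) (by simp [h₂]) (by simp [h₁])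
  obtain ⟨t, ht₁, ht₂⟩ := difunctional r₁ r₂ (pullback.fst r₂ r₁)
    (pullback.fst r₂ r₁ ≫ r₂ ≫ e) (pullback.snd r₂ r₁) (by simp [h₂])
    (by simp [h₁, pullback.condition])
  exact ⟨⟨{
    right_cancellation := JointlyMono₂.right_cancellation
    r := e
    reflexivity₁ := h₁
    reflexivity₂ := h₂
    s := s
    symmetry₁ := by simp [hs₁, h₁]
    symmetry₂ := by simp [hs₂, h₂]
    c := _
    isLimit := pullback.isLimit r₂ r₁
    t := t
    transitivity₁ := ht₁
    transitivity₂ := ht₂ }⟩⟩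

lemma factor (A B : C) (f : A ⟶ B) : ∃ (I : C) (e : A ⟶ I) (m : I ⟶ B) (_ : IsRegularEpi e)
    (_ : Mono m), e ≫ m = f :=
  ⟨_, (Regular.strongEpiMonoFactorisation f).e, (Regular.strongEpiMonoFactorisation f).m,
    inferInstance, inferInstance, (Regular.strongEpiMonoFactorisation f).fac⟩

/-- A subobject closed under conjugation is a kernel. -/
lemma normal_of_conj {G A : C} (m : G ⟶ A) [Mono m] (ζ : flat A G ⟶ G)
    (hζ : ζ ≫ m = flatMap (𝟙 A) m ≫ conj A) :
    ∃ (Q : C) (q : A ⟶ Q) (_ : IsRegularEpi q), IsKernel m q := by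
  obtain ⟨R, e, i, he, hi, hei⟩ := factor _ _
    (coprod.desc (prod.lift (𝟙 A) (𝟙 A)) (prod.lift m (0 : G ⟶ A)))
  have hj : JointlyMono₂ (i ≫ prod.fst) (i ≫ prod.snd) := ⟨fun Y x y h₁ h₂ => by
    rw [← cancel_mono i]
    exact Limits.prod.hom_ext (by simpa using h₁) (by simpa using h₂)⟩
  have hfst : e ≫ i ≫ prod.fst = coprod.desc (𝟙 A) m := by
    rw [← Category.assoc, hei]; ext <;> simp
  have hsnd : e ≫ i ≫ prod.snd = coprod.desc (𝟙 A) 0 := by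
    rw [← Category.assoc, hei]; ext <;> simp
  obtain ⟨Y, f, hf⟩ := SemiAbelian.effective _ _ (equivalence_of_reflexive (i ≫ prod.fst)
    (i ≫ prod.snd) (coprod.inl ≫ e) (by rw [Category.assoc, hfst]; simp)
    (by rw [Category.assoc, hsnd]; simp))
  have hmf : m ≫ f = 0 := by
    have := congrArg (fun t => coprod.inr ≫ e ≫ t) hf.w
    simp only [← Category.assoc] at this
    simp only [Category.assoc] at this hfst hsnd
    rw [reassoc_of% hfst, reassoc_of% hsnd] at this
    simpa using this
  have hker : ∀ {T : C} (x : T ⟶ A), x ≫ f = 0 → ∃ y : T ⟶ G, y ≫ m = x := by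
    intro T x hx
    have hd₁ := hf.lift_fst x 0 (by simp [hx])
    have hd₂ := hf.lift_snd x 0 (by simp [hx])
    generalize hf.lift x 0 (by simp [hx]) = d at hd₁ hd₂
    obtain ⟨T', c, hc, y, hy⟩ := covering e d
    obtain ⟨y', hy'⟩ := (isKernel_flatι A G).fac y (by
      rw [← hsnd, ← Category.assoc, ← hy, Category.assoc, hd₂, comp_zero])
    refine fac_of_cover c x m (y' ≫ ζ) ?_
    rw [Category.assoc, hζ, flatMap_conj_eq, ← hfst, ← Category.assoc, hy', ← Category.assoc, ← hy,
      Category.assoc, hd₁]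
  obtain ⟨Q, q, n, hq, hn, hqn⟩ := factor _ _ f
  refine ⟨Q, q, hq, IsKernel.mk' ?_ fun x hx => hker x ?_⟩
  · rw [← cancel_mono n, Category.assoc, hqn, hmf, zero_comp]
  · rw [← hqn, ← Category.assoc, hx, zero_comp]

lemma isRegularEpi_on_kernels {A P B K K' : C} (f : A ⟶ P) [IsRegularEpi f] (p : P ⟶ B)
    {k : K ⟶ A} {k' : K' ⟶ P} (hk : IsKernel k (f ≫ p)) (hk' : IsKernel k' p) (h : K ⟶ K')
    (hh : h ≫ k' = k ≫ f) : IsRegularEpi h := by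
  have : Mono k' := hk'.mono
  obtain ⟨z, hz⟩ := hk.fac (pullback.fst f k') (by
    rw [← Category.assoc, pullback.condition, Category.assoc, hk'.w, comp_zero])
  have e : z ≫ h = pullback.snd f k' := by
    rw [← cancel_mono k', Category.assoc, hh, ← Category.assoc, hz, pullback.condition]
  exact isRegularEpi_of_comp z h (by rw [e]; infer_instance)

/-- `♭` preserves regular epimorphisms in its first variable. -/
lemma isRegularEpi_flatMap {A Q : C} (q : A ⟶ Q) [IsRegularEpi q] (X : C) :
    IsRegularEpi (flatMap q (𝟙 X)) := by
  let π : Q ⨿ X ⟶ Q := coprod.desc (𝟙 Q) 0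
  have hN := isKernel_kernel q
  set n := kernel.ι q
  let f : A ⨿ X ⟶ pullback π q := pullback.lift (coprod.map q (𝟙 X)) (coprod.desc (𝟙 A) 0) (by
    ext <;> simp [π])
  have hmap : IsRegularEpi (coprod.map q (𝟙 X)) := by
    refine isRegularEpi_of_extremal _ fun {M} g m _ hg => ?_
    obtain ⟨w, hw⟩ := fac_of_cover q coprod.inl m (coprod.inl ≫ g) (by simp [hg])
    have : IsSplitEpi m := ⟨⟨⟨coprod.desc w (coprod.inr ≫ g), by ext <;> simp [hw, hg]⟩⟩⟩
    exact isIso_of_mono_of_isSplitEpi m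
  have hf : IsRegularEpi f := by
    refine isRegularEpi_of_extremal f fun {I} g m _ hg => ?_
    have hreg : IsRegularEpi (m ≫ pullback.fst π q) := isRegularEpi_of_comp g _ (by
      rw [← Category.assoc, hg]; simpa [f] using hmap)
    have hk := isKernel_pullback_fst (m ≫ pullback.fst π q) (isKernel_pullback_fst π hN)
    refine point_gen hk (s := pullback.lift (𝟙 I) m (by simp)) (by simp)
      (pullback.snd _ _) m (n ≫ coprod.inl ≫ g) ?_ (𝟙 I) (by simp)
    simp only [Category.assoc, hg]
    apply pullback.hom_ext
    · simp [f, reassoc_of% hN.w]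
    · simp [f]
  refine isRegularEpi_on_kernels f (pullback.snd π q) (k := flatι A X)
    (k' := pullback.lift (flatι Q X) 0 (by simp [π])) ?_
    (isKernel_pullback_snd q (isKernel_flatι Q X)) _ ?_
  · simpa [f] using isKernel_flatι A X
  · apply pullback.hom_ext <;> simp [f]

end Flat

section Actions

attribute [local simp] pullback.lift_fst pullback.lift_fst_assoc pullback.lift_snd
  pullback.lift_snd_assoc coprod.inl_desc coprod.inl_desc_assoc coprod.inr_desc
  coprod.inr_desc_assoc prod.lift_fst prod.lift_fst_assoc prod.lift_snd prod.lift_snd_assoc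

set_option linter.unusedSectionVars false

variable {C : Type u} [Category.{v} C] [HasZeroMorphisms C] [SemiAbelian C]

/-- An internal action of `B` on `X`: an algebra structure on `X` for the monad `B ♭ (-)`. -/
structure InternalAction (B X : C) where
  act : flat B X ⟶ X
  unit : flatUnit B X ≫ act = 𝟙 X
  assoc : flatMul B X ≫ act = flatMap (𝟙 B) act ≫ act

section
variable {B X : C} (ξ : InternalAction B X)

lemma semidirect_aux : ∃ (R : C) (e : B ⨿ flat B X ⟶ R) (r₁ r₂ : R ⟶ B ⨿ X) (Y : C)
    (f : B ⨿ X ⟶ Y), IsRegularEpi e ∧ IsKernelPair f r₁ r₂ ∧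
      e ≫ r₁ = coprod.map (𝟙 B) ξ.act ∧ e ≫ r₂ = coprod.desc coprod.inl (flatι B X) := by
  obtain ⟨R, e, i, he, hi, hei⟩ := factor _ _
    (prod.lift (coprod.map (𝟙 B) ξ.act) (coprod.desc coprod.inl (flatι B X)))
  have hj : JointlyMono₂ (i ≫ prod.fst) (i ≫ prod.snd) := ⟨fun Y x y h₁ h₂ => by
    rw [← cancel_mono i]
    exact Limits.prod.hom_ext (by simpa using h₁) (by simpa using h₂)⟩
  have h₁ : e ≫ i ≫ prod.fst = coprod.map (𝟙 B) ξ.act := by rw [← Category.assoc, hei]; simp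
  have h₂ : e ≫ i ≫ prod.snd = coprod.desc coprod.inl (flatι B X) := by
    rw [← Category.assoc, hei]; simp
  obtain ⟨Y, f, hf⟩ := SemiAbelian.effective _ _ (equivalence_of_reflexive (i ≫ prod.fst)
    (i ≫ prod.snd) (coprod.desc coprod.inl (flatUnit B X ≫ coprod.inr) ≫ e)
    (by rw [Category.assoc, h₁]; ext <;> simp [reassoc_of% ξ.unit])
    (by rw [Category.assoc, h₂]; ext <;> simp))
  exact ⟨R, e, _, _, Y, f, he, hf, h₁, h₂⟩

lemma coeq_cond_iff {R Z : C} {e : B ⨿ flat B X ⟶ R} {r₁ r₂ : R ⟶ B ⨿ X} (he : IsRegularEpi e)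
    (h₁ : e ≫ r₁ = coprod.map (𝟙 B) ξ.act) (h₂ : e ≫ r₂ = coprod.desc coprod.inl (flatι B X))
    (t : B ⨿ X ⟶ Z) : flatι B X ≫ t = (ξ.act ≫ coprod.inr) ≫ t ↔ r₁ ≫ t = r₂ ≫ t := by
  rw [← cancel_epi e, ← Category.assoc, ← Category.assoc, h₁, h₂]
  constructor
  · intro h
    ext
    · simp
    · simpa using h.symm
  · intro h
    simpa using (congrArg (coprod.inr ≫ ·) h).symm

instance : HasCoequalizer (flatι B X) (ξ.act ≫ coprod.inr) := by
  obtain ⟨R, e, r₁, r₂, Y, f, he, hf, h₁, h₂⟩ := semidirect_aux ξ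
  have := Regular.hasCoequalizer_of_isKernelPair hf
  have iff {Z : C} (t : B ⨿ X ⟶ Z) := coeq_cond_iff ξ he h₁ h₂ t
  exact ⟨⟨⟨Cofork.ofπ (coequalizer.π r₁ r₂) ((iff _).2 (coequalizer.condition r₁ r₂)),
    Cofork.IsColimit.mk _ (fun s => coequalizer.desc s.π ((iff _).1 s.condition))
      (fun s => coequalizer.π_desc _ _)
      (fun s m hm => (cancel_epi (coequalizer.π r₁ r₂)).1 (hm.trans (coequalizer.π_desc _ _).symm))⟩⟩⟩

/-- The semidirect product `X ⋊ B` of an internal action `ξ` of `B` on `X`. -/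
noncomputable def semidirect : C := coequalizer (flatι B X) (ξ.act ≫ coprod.inr)

/-- The canonical morphism `B + X ⟶ X ⋊ B`. -/
noncomputable def semidirectπ : B ⨿ X ⟶ semidirect ξ := coequalizer.π _ _

instance : IsRegularEpi (semidirectπ ξ) :=
  inferInstanceAs (IsRegularEpi (coequalizer.π (flatι B X) (ξ.act ≫ coprod.inr)))

lemma semidirectπ_w : flatι B X ≫ semidirectπ ξ = ξ.act ≫ coprod.inr ≫ semidirectπ ξ :=
  (coequalizer.condition _ _).trans (Category.assoc _ _ _)

/-- The canonical injection `B ⟶ X ⋊ B`. -/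
noncomputable def semidirectSection : B ⟶ semidirect ξ := coprod.inl ≫ semidirectπ ξ

/-- The canonical injection `X ⟶ X ⋊ B`. -/
noncomputable def semidirectKernel : X ⟶ semidirect ξ := coprod.inr ≫ semidirectπ ξ

lemma semidirectπ_cond {Z : C} (t : semidirect ξ ⟶ Z) : 
    flatι B X ≫ coprod.desc (semidirectSection ξ ≫ t) (semidirectKernel ξ ≫ t) =
      ξ.act ≫ semidirectKernel ξ ≫ t := by
  have : coprod.desc (semidirectSection ξ ≫ t) (semidirectKernel ξ ≫ t) = semidirectπ ξ ≫ t := by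
    ext <;> simp [semidirectSection, semidirectKernel]
  rw [this, ← Category.assoc, semidirectπ_w]
  simp [semidirectKernel]

/-- The morphism out of `X ⋊ B` induced by morphisms out of `B` and `X`. -/
noncomputable def semidirectDesc {Z : C} (u : B ⟶ Z) (v : X ⟶ Z)
    (h : flatι B X ≫ coprod.desc u v = ξ.act ≫ v) : semidirect ξ ⟶ Z :=
  coequalizer.desc (coprod.desc u v) (by simpa using h)

@[simp]
lemma semidirectπ_desc {Z : C} (u : B ⟶ Z) (v : X ⟶ Z)
    (h : flatι B X ≫ coprod.desc u v = ξ.act ≫ v) :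
    semidirectπ ξ ≫ semidirectDesc ξ u v h = coprod.desc u v := coequalizer.π_desc _ _

@[simp]
lemma semidirectSection_desc {Z : C} (u : B ⟶ Z) (v : X ⟶ Z)
    (h : flatι B X ≫ coprod.desc u v = ξ.act ≫ v) :
    semidirectSection ξ ≫ semidirectDesc ξ u v h = u := by
  simp [semidirectSection]

@[simp]
lemma semidirectKernel_desc {Z : C} (u : B ⟶ Z) (v : X ⟶ Z)
    (h : flatι B X ≫ coprod.desc u v = ξ.act ≫ v) :
    semidirectKernel ξ ≫ semidirectDesc ξ u v h = v := by
  simp [semidirectKernel]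

/-- The canonical projection `X ⋊ B ⟶ B`. -/
noncomputable def semidirectProj : semidirect ξ ⟶ B := semidirectDesc ξ (𝟙 B) 0 (by simp)

lemma semidirect_isKernel : IsKernel (semidirectKernel ξ) (semidirectProj ξ) := by
  obtain ⟨R, e, r₁, r₂, Y, f, he, hf, h₁, h₂⟩ := semidirect_aux ξ
  have hq : semidirectπ ξ ≫ coequalizer.desc f ((coeq_cond_iff ξ he h₁ h₂ f).2 hf.w) = f :=
    coequalizer.π_desc _ _
  have hq' : r₁ ≫ semidirectπ ξ = r₂ ≫ semidirectπ ξ :=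
    (coeq_cond_iff ξ he h₁ h₂ _).1 (coequalizer.condition _ _)
  have hkp : IsKernelPair (semidirectπ ξ) r₁ r₂ := by
    rw [← hq] at hf
    exact hf.cancel_right hq'
  have hp : semidirectπ ξ ≫ semidirectProj ξ = coprod.desc (𝟙 B) 0 := coequalizer.π_desc _ _
  have w : semidirectKernel ξ ≫ semidirectProj ξ = 0 := semidirectKernel_desc ..
  obtain ⟨g, hg⟩ := (isKernel_kernel (semidirectProj ξ)).fac _ w
  have hgr : IsRegularEpi g := by
    refine isRegularEpi_of_comp ξ.act g (isRegularEpi_on_kernels (semidirectπ ξ) (semidirectProj ξ)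
      (k := flatι B X) (by rw [hp]; exact isKernel_flatι B X)
      (isKernel_kernel (semidirectProj ξ)) _ ?_)
    rw [Category.assoc, hg]
    exact (semidirectπ_w ξ).symm
  have hgm : Mono g := by
    refine mono_of_trivial_kernel g fun {T} t ht => ?_
    have ht' : (t ≫ coprod.inr) ≫ semidirectπ ξ = (0 : T ⟶ B ⨿ X) ≫ semidirectπ ξ := by
      have : t ≫ semidirectKernel ξ = 0 := by rw [← hg, ← Category.assoc, ht, zero_comp]
      simpa [semidirectKernel] using this
    have hd₁ := hkp.lift_fst _ _ ht'
    have hd₂ := hkp.lift_snd _ _ ht'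
    generalize hkp.lift _ _ ht' = d at hd₁ hd₂
    obtain ⟨T', c, hc, y, hy⟩ := covering e d
    have hy₁ : y ≫ coprod.map (𝟙 B) ξ.act = c ≫ t ≫ coprod.inr := by
      rw [← h₁, ← Category.assoc, ← hy, Category.assoc, hd₁]
    have hy₂ : y ≫ coprod.desc coprod.inl (flatι B X) = 0 := by
      rw [← h₂, ← Category.assoc, ← hy, Category.assoc, hd₂, comp_zero]
    obtain ⟨τ, hτ⟩ := (isKernel_flatι B (flat B X)).fac y (by
      have : coprod.desc coprod.inl (flatι B X) ≫ coprod.desc (𝟙 B) 0 = coprod.desc (𝟙 B) 0 := by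
        ext <;> simp
      rw [← this, ← Category.assoc, hy₂, zero_comp])
    have e₁ : τ ≫ flatMap (𝟙 B) ξ.act = c ≫ t ≫ flatUnit B X := by
      rw [← cancel_mono (flatι B X)]
      simp [← hy₁, ← hτ]
    have e₂ : τ ≫ flatMul B X = 0 := by
      rw [← cancel_mono (flatι B X)]
      simp [← hy₂, ← hτ]
    rw [← cancel_epi c, comp_zero]
    calc c ≫ t = (c ≫ t ≫ flatUnit B X) ≫ ξ.act := by simp [ξ.unit]
      _ = 0 := by rw [← e₁, Category.assoc, ← ξ.assoc, reassoc_of% e₂, zero_comp]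
  have : IsIso g := isIso_of_regularEpi_fac g (𝟙 _) g (by simp)
  have : Mono (semidirectKernel ξ) := by rw [← hg]; infer_instance
  refine IsKernel.mk' w fun x hx => ?_
  obtain ⟨y, hy⟩ := (isKernel_kernel (semidirectProj ξ)).fac x hx
  exact ⟨y ≫ inv g, by rw [← hg, Category.assoc, IsIso.inv_hom_id_assoc, hy]⟩

@[simp]
lemma semidirectSection_proj : semidirectSection ξ ≫ semidirectProj ξ = 𝟙 B :=
  semidirectSection_desc ..

@[simp]
lemma semidirectKernel_proj : semidirectKernel ξ ≫ semidirectProj ξ = 0 :=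
  semidirectKernel_desc ..

lemma semidirect_hom_ext {Z : C} {f g : semidirect ξ ⟶ Z}
    (h₁ : semidirectSection ξ ≫ f = semidirectSection ξ ≫ g)
    (h₂ : semidirectKernel ξ ≫ f = semidirectKernel ξ ≫ g) : f = g :=
  point_ext (semidirect_isKernel ξ) (semidirectSection_proj ξ) f g h₂ h₁

end

section
variable {K A B Z : C} {k : K ⟶ A} {p : A ⟶ B} {s : B ⟶ A}

/-- A point is the semidirect product of the conjugation action on its kernel. -/
lemma point_desc (hk : IsKernel k p) (hs : s ≫ p = 𝟙 B) (α : flat B K ⟶ K)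
    (hα : α ≫ k = flatι B K ≫ coprod.desc s k) (u : B ⟶ Z) (v : K ⟶ Z)
    (h : flatι B K ≫ coprod.desc u v = α ≫ v) : ∃ w : A ⟶ Z, s ≫ w = u ∧ k ≫ w = v := by
  have : Mono k := hk.mono
  have : IsRegularEpi (coprod.desc s k) := isRegularEpi_of_extremal _ fun g m _ hg =>
    point_iso hk hs m (coprod.inr ≫ g) (by simp [hg]) (coprod.inl ≫ g) (by simp [hg])
  have hn := isKernel_kernel (coprod.desc s k)
  set n := kernel.ι (coprod.desc s k)
  have hp : coprod.desc (𝟙 B) (0 : K ⟶ B) = coprod.desc s k ≫ p := by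
    ext <;> simp [hs, hk.w]
  obtain ⟨z, hz⟩ := (isKernel_flatι B K).fac n (by rw [hp, ← Category.assoc, hn.w, zero_comp])
  have hzα : z ≫ α = 0 := by
    rw [← cancel_mono k, Category.assoc, hα, ← Category.assoc, hz, hn.w, zero_comp]
  obtain ⟨w, hw⟩ := (isCokernel_of_regularEpi hn).fac (coprod.desc u v) (by
    rw [← hz, Category.assoc, h, ← Category.assoc, hzα, zero_comp])
  exact ⟨w, by simpa using congrArg (coprod.inl ≫ ·) hw, by simpa using congrArg (coprod.inr ≫ ·) hw⟩

lemma point_act (α : flat B K ⟶ K) (hα : α ≫ k = flatι B K ≫ coprod.desc s k) (w : A ⟶ Z) :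
    flatι B K ≫ coprod.desc (s ≫ w) (k ≫ w) = α ≫ k ≫ w := by
  have : coprod.desc (s ≫ w) (k ≫ w) = coprod.desc s k ≫ w := by ext <;> simp
  rw [this, ← Category.assoc, ← Category.assoc, hα]

end

/-- The action along which the pullback of a semidirect product is again one. -/
lemma pullback_act {A B X : C} (ξ : InternalAction B X) (f : A ⟶ B) :
    (flatMap f (𝟙 X) ≫ ξ.act) ≫ pullback.lift (0 : X ⟶ A) (semidirectKernel ξ) (by simp) =
      flatι A X ≫ coprod.desc
        (pullback.lift (𝟙 A) (f ≫ semidirectSection ξ) (by simp) :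
          A ⟶ pullback f (semidirectProj ξ))
        (pullback.lift (0 : X ⟶ A) (semidirectKernel ξ) (by simp)) := by
  apply pullback.hom_ext
  · have : coprod.desc (pullback.lift (𝟙 A) (f ≫ semidirectSection ξ) (by simp) :
          A ⟶ pullback f (semidirectProj ξ))
        (pullback.lift (0 : X ⟶ A) (semidirectKernel ξ) (by simp)) ≫ pullback.fst _ _ =
        coprod.desc (𝟙 A) 0 := by ext <;> simp
    simp only [Category.assoc, this]
    simp
  · have : coprod.desc (pullback.lift (𝟙 A) (f ≫ semidirectSection ξ) (by simp) :
          A ⟶ pullback f (semidirectProj ξ))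
        (pullback.lift (0 : X ⟶ A) (semidirectKernel ξ) (by simp)) ≫ pullback.snd _ _ =
        coprod.map f (𝟙 X) ≫ coprod.desc (semidirectSection ξ) (semidirectKernel ξ) := by
      ext <;> simp
    simp only [Category.assoc, this]
    have h := semidirectπ_cond ξ (𝟙 _)
    simp only [Category.comp_id] at h
    rw [pullback.lift_snd, ← h, ← Category.assoc, flatMap_ι, Category.assoc]

end Actions

section Butterflies

attribute [local simp] pullback.lift_fst pullback.lift_fst_assoc pullback.lift_snd
  pullback.lift_snd_assoc coprod.inl_desc coprod.inl_desc_assoc coprod.inr_desc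
  coprod.inr_desc_assoc prod.lift_fst prod.lift_fst_assoc prod.lift_snd prod.lift_snd_assoc

set_option linter.unusedSectionVars false

/-- Internal crossed modules `∂ : G ⟶ G₀` (`top` is `G`, `base` is `G₀`): an action of `G₀` on `G`
satisfying the Peiffer condition and the precrossed module condition. -/
structure CrossedModule (C : Type u) [Category.{v} C] [HasZeroMorphisms C] [SemiAbelian C] where
  top : C
  base : C
  bd : top ⟶ base
  action : InternalAction base top
  peiffer : flatMap bd (𝟙 top) ≫ action.act = conj top
  precrossed : action.act ≫ bd = flatMap (𝟙 base) bd ≫ conj base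

variable {C : Type u} [Category.{v} C] [HasZeroMorphisms C] [SemiAbelian C]

namespace CrossedModule

variable (G : CrossedModule C)

/-- The object of arrows `G₁ = G ⋊ G₀` of the groupoid associated with `G`. -/
noncomputable def arr : C := semidirect G.action

/-- The identity-arrow morphism `e : G₀ ⟶ G₁`. -/
noncomputable def e : G.base ⟶ G.arr := semidirectSection G.action

/-- The kernel `g : G ⟶ G₁` of the codomain morphism. -/
noncomputable def g : G.top ⟶ G.arr := semidirectKernel G.action

/-- The codomain morphism `c : G₁ ⟶ G₀`. -/
noncomputable def c : G.arr ⟶ G.base := semidirectProj G.action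

/-- The domain morphism `d = [∂, 1] : G₁ ⟶ G₀`. -/
noncomputable def d : G.arr ⟶ G.base := semidirectDesc G.action (𝟙 _) G.bd (by
  rw [← flatMap_conj_eq, G.precrossed])

@[simp] lemma e_c : G.e ≫ G.c = 𝟙 _ := semidirectSection_proj _
@[simp] lemma g_c : G.g ≫ G.c = 0 := semidirectKernel_proj _
@[simp] lemma e_d : G.e ≫ G.d = 𝟙 _ := semidirectSection_desc ..
@[simp] lemma g_d : G.g ≫ G.d = G.bd := semidirectKernel_desc ..
@[simp] lemma e_c_assoc {Z : C} (z : G.base ⟶ Z) : G.e ≫ G.c ≫ z = z := by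
  rw [← Category.assoc, e_c, Category.id_comp]
@[simp] lemma g_c_assoc {Z : C} (z : G.base ⟶ Z) : G.g ≫ G.c ≫ z = 0 := by
  rw [← Category.assoc, g_c, zero_comp]
@[simp] lemma e_d_assoc {Z : C} (z : G.base ⟶ Z) : G.e ≫ G.d ≫ z = z := by
  rw [← Category.assoc, e_d, Category.id_comp]
@[simp] lemma g_d_assoc {Z : C} (z : G.base ⟶ Z) : G.g ≫ G.d ≫ z = G.bd ≫ z := by
  rw [← Category.assoc, g_d]

lemma isKernel_g : IsKernel G.g G.c := semidirect_isKernel G.action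

lemma arr_ext {Z : C} {x y : G.arr ⟶ Z} (h₁ : G.e ≫ x = G.e ≫ y) (h₂ : G.g ≫ x = G.g ≫ y) :
    x = y := semidirect_hom_ext G.action h₁ h₂

lemma flatι_e_g : flatι G.base G.top ≫ coprod.desc G.e G.g = G.action.act ≫ G.g := by
  have h := semidirectπ_cond G.action (𝟙 _)
  simp only [Category.comp_id] at h
  exact h

lemma isKernel_prod_snd (X Y : C) :
    IsKernel (prod.lift (𝟙 X) (0 : X ⟶ Y)) (prod.snd : X ⨯ Y ⟶ Y) := by
  have : Mono (prod.lift (𝟙 X) (0 : X ⟶ Y)) := mono_of_mono_fac (prod.lift_fst (𝟙 X) (0 : X ⟶ Y))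
  refine IsKernel.mk' (by simp) fun x hx => ⟨x ≫ prod.fst, ?_⟩
  ext <;> simp [hx]

lemma exists_division : ∃ m : G.top ⨯ G.top ⟶ G.arr,
    prod.lift (𝟙 _) 0 ≫ m = G.g ∧ prod.lift (𝟙 _) (𝟙 _) ≫ m = G.bd ≫ G.e := by
  obtain ⟨w, h₁, h₂⟩ := point_desc (isKernel_prod_snd G.top G.top) (s := prod.lift (𝟙 _) (𝟙 _))
    (by simp) (conj G.top) (by
      have e₁ : coprod.desc (prod.lift (𝟙 G.top) (𝟙 G.top)) (prod.lift (𝟙 G.top) (0 : _ ⟶ G.top))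
        ≫ prod.fst = coprod.desc (𝟙 _) (𝟙 _) := by ext <;> simp
      have e₂ : coprod.desc (prod.lift (𝟙 G.top) (𝟙 G.top)) (prod.lift (𝟙 G.top) (0 : _ ⟶ G.top))
        ≫ prod.snd = coprod.desc (𝟙 _) 0 := by ext <;> simp
      apply Limits.prod.hom_ext
      · simp [e₁, conj]
      · simp [e₂]) (G.bd ≫ G.e) G.g (by
      rw [← G.peiffer, Category.assoc, ← flatι_e_g, ← Category.assoc, flatMap_ι, Category.assoc]
      congr 1
      ext <;> simp)
  exact ⟨w, h₂, h₁⟩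

/-- The division morphism `G × G ⟶ G₁` of the groupoid: the unique morphism which restricts to `g`
along `⟨1, 0⟩` and to `∂ ≫ e` along the diagonal. It sends `(a : x ⟶ 0, b : y ⟶ 0)` to `a b⁻¹`. -/
noncomputable def division : G.top ⨯ G.top ⟶ G.arr := G.exists_division.choose

@[simp] lemma inl_division : prod.lift (𝟙 _) 0 ≫ G.division = G.g := G.exists_division.choose_spec.1
@[simp] lemma diag_division : prod.lift (𝟙 _) (𝟙 _) ≫ G.division = G.bd ≫ G.e :=
  G.exists_division.choose_spec.2

lemma lift_zero_division {T : C} (x : T ⟶ G.top) : prod.lift x 0 ≫ G.division = x ≫ G.g := by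
  rw [← inl_division, ← Category.assoc]; congr 1; ext <;> simp

lemma lift_diag_division {T : C} (x : T ⟶ G.top) : prod.lift x x ≫ G.division = x ≫ G.bd ≫ G.e := by
  rw [← diag_division, ← Category.assoc]; congr 1; ext <;> simp

/-- The morphism `g• = g ≫ i : G ⟶ G₁`, where `i` is the inversion of the groupoid; it sends
`b : y ⟶ 0` to `b⁻¹` and is a kernel of the domain morphism, see `isKernel_gInv`. -/
noncomputable def gInv : G.top ⟶ G.arr := prod.lift 0 (𝟙 _) ≫ G.division

lemma zero_lift_division {T : C} (x : T ⟶ G.top) : prod.lift 0 x ≫ G.division = x ≫ G.gInv := by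
  rw [gInv, ← Category.assoc]; congr 1; ext <;> simp

lemma prod_ext {X Y Z : C} {f g : X ⨯ Y ⟶ Z} (h₁ : prod.lift (𝟙 X) 0 ≫ f = prod.lift (𝟙 X) 0 ≫ g)
    (h₂ : prod.lift 0 (𝟙 Y) ≫ f = prod.lift 0 (𝟙 Y) ≫ g) : f = g :=
  point_ext (isKernel_prod_snd X Y) (s := prod.lift 0 (𝟙 Y)) (by simp) f g h₁ h₂

lemma diag_ext {X Z : C} {f g : X ⨯ X ⟶ Z} (h₁ : prod.lift (𝟙 X) 0 ≫ f = prod.lift (𝟙 X) 0 ≫ g)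
    (h₂ : prod.lift (𝟙 X) (𝟙 X) ≫ f = prod.lift (𝟙 X) (𝟙 X) ≫ g) : f = g :=
  point_ext (isKernel_prod_snd X X) (s := prod.lift (𝟙 X) (𝟙 X)) (by simp) f g h₁ h₂

lemma division_c : G.division ≫ G.c = prod.snd ≫ G.bd := by
  apply diag_ext
  · rw [← Category.assoc, inl_division]; simp
  · rw [← Category.assoc, diag_division]; simp

lemma division_d : G.division ≫ G.d = prod.fst ≫ G.bd := by
  apply diag_ext
  · rw [← Category.assoc, inl_division]; simp
  · rw [← Category.assoc, diag_division]; simp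

@[simp] lemma gInv_c : G.gInv ≫ G.c = G.bd := by simp [gInv, division_c]
@[simp] lemma gInv_d : G.gInv ≫ G.d = 0 := by simp [gInv, division_d]

lemma isIso_division_lift : IsIso (pullback.lift prod.snd G.division G.division_c.symm :
    G.top ⨯ G.top ⟶ pullback G.bd G.c) := by
  refine SemiAbelian.split_short_five (prod.lift (𝟙 G.top) (0 : _ ⟶ G.top)) prod.snd
    (prod.lift (𝟙 _) (𝟙 _)) _ (pullback.fst G.bd G.c)
    (pullback.lift (𝟙 _) (G.bd ≫ G.e) (by simp)) (𝟙 _) _ (𝟙 _)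
    (isKernel_prod_snd _ _) (isKernel_pullback_fst G.bd G.isKernel_g) (by simp) (by simp)
    ?_ (by simp) ?_ inferInstance inferInstance
  · apply pullback.hom_ext <;> simp
  · apply pullback.hom_ext <;> simp

lemma division_ext {T : C} {x y : T ⟶ G.top ⨯ G.top} (h₁ : x ≫ prod.snd = y ≫ prod.snd)
    (h₂ : x ≫ G.division = y ≫ G.division) : x = y := by
  have := G.isIso_division_lift
  rw [← cancel_mono (pullback.lift prod.snd G.division G.division_c.symm :
    G.top ⨯ G.top ⟶ pullback G.bd G.c)]
  apply pullback.hom_ext <;> simp [h₁, h₂]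

lemma division_surj {T : C} (b : T ⟶ G.top) (y : T ⟶ G.arr) (h : b ≫ G.bd = y ≫ G.c) :
    ∃ t : T ⟶ G.top ⨯ G.top, t ≫ prod.snd = b ∧ t ≫ G.division = y := by
  have := G.isIso_division_lift
  set φ := (pullback.lift prod.snd G.division G.division_c.symm :
    G.top ⨯ G.top ⟶ pullback G.bd G.c) with hφ
  have h₁ : φ ≫ pullback.fst _ _ = prod.snd := by simp [hφ]
  have h₂ : φ ≫ pullback.snd _ _ = G.division := by simp [hφ]
  exact ⟨pullback.lift b y h ≫ inv φ, by simp [← h₁], by simp [← h₂]⟩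

lemma division_kernel {T : C} {t : T ⟶ G.top ⨯ G.top} (h : t ≫ G.division = 0) :
    t = prod.lift (t ≫ prod.snd) (t ≫ prod.snd) := by
  apply G.division_ext (by simp)
  have : t ≫ prod.snd ≫ G.bd = 0 := by
    rw [← division_c, ← Category.assoc, h, zero_comp]
  rw [lift_diag_division, h, Category.assoc, reassoc_of% this, zero_comp]

lemma division_move {T : C} (t : T ⟶ G.top ⨯ G.top) (p : T ⟶ G.top)
    (h : t ≫ prod.fst ≫ G.bd = p ≫ G.bd) :
    ∃ t' : T ⟶ G.top ⨯ G.top, t' ≫ prod.fst = p ∧ t' ≫ G.division = t ≫ G.division := by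
  have hn := isKernel_kernel G.bd
  set n := kernel.ι G.bd
  have hk : IsKernel (prod.lift n n) G.division := by
    have : Mono n := hn.mono
    have : Mono (prod.lift n n) := mono_of_mono_fac (prod.lift_fst n n)
    refine IsKernel.mk' (by rw [lift_diag_division, reassoc_of% hn.w, zero_comp]) fun x hx => ?_
    have e := G.division_kernel hx
    obtain ⟨y, hy⟩ := hn.fac (x ≫ prod.snd) (by
      rw [Category.assoc, ← division_c, ← Category.assoc, hx, zero_comp])
    exact ⟨y, by rw [e, ← hy]; ext <;> simp⟩
  let f : G.top ⨯ G.top ⟶ G.base := prod.fst ≫ G.bd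
  let φ : pullback G.division G.division ⟶ pullback f G.bd :=
    pullback.lift (pullback.fst _ _) (pullback.snd _ _ ≫ prod.fst) (by
      simp only [f, ← division_d, Category.assoc]
      rw [← Category.assoc, pullback.condition, Category.assoc])
  have : IsIso φ := by
    refine SemiAbelian.split_short_five _ (pullback.fst G.division G.division)
      (pullback.lift (𝟙 _) (𝟙 _) rfl) _ (pullback.fst f G.bd)
      (pullback.lift (𝟙 _) prod.fst (by simp [f])) (𝟙 _) φ (𝟙 _)
      (isKernel_pullback_fst _ hk) (isKernel_pullback_fst f hn) (by simp) (by simp)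
      ?_ (by simp [φ]) ?_ inferInstance inferInstance
    · apply pullback.hom_ext <;> simp [φ]
    · apply pullback.hom_ext <;> simp [φ]
  let w : T ⟶ pullback f G.bd := pullback.lift t p (by simp [f, h])
  have h₁ : φ ≫ pullback.fst _ _ = pullback.fst _ _ := by simp [φ]
  have h₂ : φ ≫ pullback.snd _ _ = pullback.snd _ _ ≫ prod.fst := by simp [φ]
  refine ⟨w ≫ inv φ ≫ pullback.snd _ _, ?_, ?_⟩
  · simp only [Category.assoc, ← h₂, IsIso.inv_hom_id_assoc]
    simp [w]
  · simp only [Category.assoc, ← pullback.condition]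
    rw [← h₁]
    simp [w]

lemma isRegularEpi_flatMap_right {X Y : C} (B : C) (f : X ⟶ Y) [IsRegularEpi f] :
    IsRegularEpi (flatMap (𝟙 B) f) := by
  have : IsRegularEpi (coprod.map (𝟙 B) f) := by
    refine isRegularEpi_of_extremal _ fun {M} g m _ hg => ?_
    obtain ⟨w, hw⟩ := fac_of_cover f coprod.inr m (coprod.inr ≫ g) (by simp [hg])
    have : IsSplitEpi m := ⟨⟨⟨coprod.desc (coprod.inl ≫ g) w, by ext <;> simp [hw, hg]⟩⟩⟩
    exact isIso_of_mono_of_isSplitEpi m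
  refine isRegularEpi_on_kernels (coprod.map (𝟙 B) f) (coprod.desc (𝟙 B) 0) (k := flatι B X) ?_
    (isKernel_flatι B Y) _ (flatMap_ι _ _)
  simpa using isKernel_flatι B X

lemma isKernel_gInv : IsKernel G.gInv G.d := by
  have : Mono G.gInv := by
    refine mono_of_trivial_kernel _ fun t ht => ?_
    have := G.division_kernel (t := prod.lift 0 t) (by rw [zero_lift_division, ht])
    simpa using (congrArg (· ≫ prod.fst) this).symm
  refine IsKernel.mk' (by simp) fun {T} y hy => ?_
  obtain ⟨I, ε, μ, hε, hμ, hεμ⟩ := factor _ _ G.bd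
  have := isRegularEpi_flatMap_right G.base ε
  obtain ⟨ζ, hζ⟩ := fac_of_cover (flatMap (𝟙 G.base) ε) (flatMap (𝟙 G.base) μ ≫ conj G.base) μ
    (G.action.act ≫ ε) (by
      rw [Category.assoc, hεμ, G.precrossed, flatMap_conj_eq, flatMap_conj_eq, ← Category.assoc,
        flatMap_ι, Category.assoc]
      congr 1
      ext <;> simp [hεμ])
  obtain ⟨Q, q, hq, hμq⟩ := normal_of_conj μ ζ hζ
  have hdc : G.d ≫ q = G.c ≫ q := by
    apply G.arr_ext
    · simp
    · simp [← hεμ, hμq.w]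
  obtain ⟨z, hz⟩ := hμq.fac (y ≫ G.c) (by
    rw [Category.assoc, ← hdc, ← Category.assoc, hy, zero_comp])
  obtain ⟨T', c', hc', b, hb⟩ := covering ε z
  obtain ⟨t, ht₁, ht₂⟩ := G.division_surj b (c' ≫ y) (by
    rw [Category.assoc, ← hz, ← Category.assoc, hb, Category.assoc, hεμ])
  obtain ⟨t', ht₁', ht₂'⟩ := G.division_move t 0 (by
    rw [← division_d, ← Category.assoc, ht₂, Category.assoc, hy]; simp)
  have ht' : t' = prod.lift 0 (t' ≫ prod.snd) := by ext <;> simp [ht₁']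
  exact fac_of_cover c' y G.gInv (t' ≫ prod.snd) (by
    rw [← zero_lift_division, ← ht', ht₂', ht₂])

end CrossedModule

end Butterflies

section ButterflyDefs

attribute [local simp] pullback.lift_fst pullback.lift_fst_assoc pullback.lift_snd
  pullback.lift_snd_assoc coprod.inl_desc coprod.inl_desc_assoc coprod.inr_desc
  coprod.inr_desc_assoc prod.lift_fst prod.lift_fst_assoc prod.lift_snd prod.lift_snd_assoc

set_option linter.unusedSectionVars false

variable {C : Type u} [Category.{v} C] [HasZeroMorphisms C] [SemiAbelian C]

/-- Internal butterflies `E : H ⟶ G`: an object `E` with wings `κ ≫ σ = ∂ : H ⟶ H₀` and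
`ι ≫ ρ = ∂ : G ⟶ G₀`, such that `(κ, ρ)` is a complex, `(ι, σ)` is an extension, and the actions of
`E` on `H` (through `σ`) and on `G` (through `ρ`) correspond to conjugation in `E` along `κ` and
`ι`. -/
structure Butterfly (H G : CrossedModule C) where
  obj : C
  κ : H.top ⟶ obj
  ρ : obj ⟶ G.base
  ι : G.top ⟶ obj
  σ : obj ⟶ H.base
  κ_σ : κ ≫ σ = H.bd
  ι_ρ : ι ≫ ρ = G.bd
  κ_ρ : κ ≫ ρ = 0
  isExtension : IsExtension ι σ
  precrossed_κ : flatMap σ (𝟙 H.top) ≫ H.action.act ≫ κ = flatMap (𝟙 obj) κ ≫ conj obj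
  precrossed_ι : flatMap ρ (𝟙 G.top) ≫ G.action.act ≫ ι = flatMap (𝟙 obj) ι ≫ conj obj

namespace Butterfly

variable {H G K L : CrossedModule C}

/-- Morphisms of butterflies: morphisms of the total objects commuting with all four arrows. -/
@[ext]
structure Hom (E E' : Butterfly H G) where
  hom : E.obj ⟶ E'.obj
  κ_hom : E.κ ≫ hom = E'.κ
  hom_ρ : hom ≫ E'.ρ = E.ρ
  ι_hom : E.ι ≫ hom = E'.ι
  hom_σ : hom ≫ E'.σ = E.σ

/-- A butterfly is flippable if its other diagonal `(κ, ρ)` is an extension too. -/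
def IsFlippable (E : Butterfly H G) : Prop := IsExtension E.κ E.ρ

/-- The butterfly obtained from a flippable butterfly by twisting its wings. -/
def flip (E : Butterfly H G) (hE : E.IsFlippable) : Butterfly G H where
  obj := E.obj
  κ := E.ι
  ρ := E.σ
  ι := E.κ
  σ := E.ρ
  κ_σ := E.ι_ρ
  ι_ρ := E.κ_σ
  κ_ρ := E.isExtension.1.w
  isExtension := hE
  precrossed_κ := E.precrossed_ι
  precrossed_ι := E.precrossed_κ

lemma act_of_map (G : CrossedModule C) {A Z : C} (f : A ⟶ G.base) (w : pullback f G.c ⟶ Z) :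
    flatι A G.top ≫ coprod.desc (pullback.lift (𝟙 A) (f ≫ G.e) (by simp) ≫ w)
      (pullback.lift (0 : G.top ⟶ A) G.g (by simp) ≫ w) =
    flatMap f (𝟙 G.top) ≫ G.action.act ≫ pullback.lift (0 : G.top ⟶ A) G.g (by simp) ≫ w :=
  (point_act _ (pullback_act G.action f) w).trans (Category.assoc _ _ _)

lemma exists_translation (G : CrossedModule C) [HuqSmith C] :
    ∀ {T : C} (x y z : T ⟶ G.arr), x ≫ G.d = y ≫ G.d → y ≫ G.c = z ≫ G.c →
      ∃ w : T ⟶ G.arr, (∀ {S : C} (s : S ⟶ T), s ≫ y = s ≫ z → s ≫ w = s ≫ x) ∧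
        (∀ {S : C} (s : S ⟶ T), s ≫ x = s ≫ y → s ≫ w = s ≫ z) := by
  have hd : IsKernelPair G.d (pullback.fst G.d G.d) (pullback.snd G.d G.d) := .of_hasPullback _
  have hc : IsKernelPair G.c (pullback.fst G.c G.c) (pullback.snd G.c G.c) := .of_hasPullback _
  let eR := IsKernelPair.equivalenceRelation G.d _ _ (pullback.isLimit _ _) hd
  let eS := IsKernelPair.equivalenceRelation G.c _ _ (pullback.isLimit _ _) hc
  obtain ⟨z₁, hz₁⟩ := G.isKernel_gInv.fac
    (kernel.ι (pullback.fst G.d G.d) ≫ pullback.snd G.d G.d) (by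
      rw [Category.assoc, ← pullback.condition, kernel.condition_assoc, zero_comp])
  obtain ⟨z₂, hz₂⟩ := G.isKernel_g.fac
    (kernel.ι (pullback.fst G.c G.c) ≫ pullback.snd G.c G.c) (by
      rw [Category.assoc, ← pullback.condition, kernel.condition_assoc, zero_comp])
  obtain ⟨Φ, h₁, h₂⟩ := HuqSmith.smith_of_huq eR eS
    ⟨prod.lift (prod.snd ≫ z₂) (prod.fst ≫ z₁) ≫ G.division, by
      rw [← hz₁, ← G.zero_lift_division, ← Category.assoc]; congr 1; ext <;> simp, by
      rw [← hz₂, ← G.lift_zero_division, ← Category.assoc]; congr 1; ext <;> simp⟩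
  have r₁ : eR.r = pullback.lift (𝟙 _) (𝟙 _) rfl := by
    apply pullback.hom_ext <;> simp [eR.reflexivity₁, eR.reflexivity₂]
  have r₂ : eS.r = pullback.lift (𝟙 _) (𝟙 _) rfl := by
    apply pullback.hom_ext <;> simp [eS.reflexivity₁, eS.reflexivity₂]
  intro T x y z hxy hyz
  refine ⟨pullback.lift (pullback.lift x y hxy) (pullback.lift y z hyz) (by simp) ≫ Φ,
    fun s hs => ?_, fun s hs => ?_⟩
  · have : s ≫ x = (s ≫ pullback.lift x y hxy) ≫ pullback.fst _ _ := by simp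
    rw [this, ← h₁, ← Category.assoc, ← Category.assoc]
    congr 1
    apply pullback.hom_ext
    · simp
    · apply pullback.hom_ext <;> simp [r₂, hs]
  · have : s ≫ z = (s ≫ pullback.lift y z hyz) ≫ pullback.snd _ _ := by simp
    rw [this, ← h₂, ← Category.assoc, ← Category.assoc]
    congr 1
    apply pullback.hom_ext
    · apply pullback.hom_ext <;> simp [r₁, hs]
    · simp

/-- The identity butterfly on `G`, with total object `G₁ = G ⋊ G₀`, the diagonals being the kernels
of the domain and of the codomain morphism of the associated groupoid. -/
noncomputable def id [HuqSmith C] (G : CrossedModule C) : Butterfly G G where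
  obj := G.arr
  κ := G.gInv
  ρ := G.d
  ι := G.g
  σ := G.c
  κ_σ := G.gInv_c
  ι_ρ := G.g_d
  κ_ρ := G.gInv_d
  isExtension := by
    have : IsSplitEpi G.c := ⟨⟨⟨G.e, G.e_c⟩⟩⟩
    have : IsRegularEpi G.c := inferInstance
    exact isExtension_of_regularEpi G.isKernel_g
  precrossed_κ := by
    obtain ⟨w, hw₁, hw₂⟩ := exists_translation G
      (pullback.snd G.c G.c ≫ G.d ≫ G.e) (pullback.snd G.c G.c) (pullback.fst G.c G.c)
      (by simp) pullback.condition.symm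
    have h := act_of_map G G.c w
    have e₁ : pullback.lift (𝟙 G.arr) (G.c ≫ G.e) (by simp) ≫ w = 𝟙 _ := by
      rw [hw₂ _ (by simp)]; simp
    have e₂ : pullback.lift (0 : G.top ⟶ G.arr) G.g (by simp) ≫ w = G.gInv := by
      have hv : pullback.lift (prod.fst ≫ G.g) (prod.snd ≫ G.g) (by simp) ≫ w = G.division := by
        apply CrossedModule.diag_ext
        · rw [← Category.assoc, hw₂ _ (by simp), G.inl_division]; simp
        · rw [← Category.assoc, hw₁ _ (by simp), G.diag_division]; simp
      rw [CrossedModule.gInv, ← hv, ← Category.assoc]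
      congr 1
      apply pullback.hom_ext <;> simp
    rw [e₁, e₂] at h
    rw [flatMap_conj_eq, h]
  precrossed_ι := by
    obtain ⟨w, hw₁, hw₂⟩ := exists_translation G
      (pullback.fst G.d G.c) (pullback.fst G.d G.c ≫ G.d ≫ G.e) (pullback.snd G.d G.c)
      (by simp) (by simp [pullback.condition])
    have h := act_of_map G G.d w
    have e₁ : pullback.lift (𝟙 G.arr) (G.d ≫ G.e) (by simp) ≫ w = 𝟙 _ := by
      rw [hw₁ _ (by simp)]; simp
    have e₂ : pullback.lift (0 : G.top ⟶ G.arr) G.g (by simp) ≫ w = G.g := by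
      rw [hw₂ _ (by simp)]; simp
    rw [e₁, e₂] at h
    rw [flatMap_conj_eq, h]

end Butterfly
end ButterflyDefs

namespace Butterfly

attribute [local simp] pullback.lift_fst pullback.lift_fst_assoc pullback.lift_snd
  pullback.lift_snd_assoc coprod.inl_desc coprod.inl_desc_assoc coprod.inr_desc
  coprod.inr_desc_assoc prod.lift_fst prod.lift_fst_assoc prod.lift_snd prod.lift_snd_assoc

set_option linter.unusedSectionVars false

variable {C : Type u} [Category.{v} C] [HasZeroMorphisms C] [SemiAbelian C]
variable {H G K L : CrossedModule C}

section Comp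

variable (E : Butterfly H G) (F : Butterfly G K)

lemma ι_σ : E.ι ≫ E.σ = 0 := E.isExtension.1.w

attribute [local simp] κ_σ ι_ρ κ_ρ ι_σ

instance : IsRegularEpi E.σ := E.isExtension.2.isRegularEpi
instance : Mono E.ι := E.isExtension.1.mono

/-- The morphism `⟨ι, κ'⟩` from `G` to the pullback of `ρ` and `σ'`. -/
noncomputable def mid : G.top ⟶ pullback E.ρ F.σ := pullback.lift E.ι F.κ (by simp)

instance : Mono (mid E F) := mono_of_mono_fac (pullback.lift_fst E.ι F.κ (by simp))

lemma mid_normal :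
    (flatMap (pullback.fst E.ρ F.σ ≫ E.ρ) (𝟙 G.top) ≫ G.action.act) ≫ mid E F =
      flatMap (𝟙 _) (mid E F) ≫ conj _ := by
  have hι := E.precrossed_ι
  have hκ := F.precrossed_κ
  rw [flatMap_conj_eq] at hι hκ ⊢
  have e₁ : coprod.desc (𝟙 _) (mid E F) ≫ pullback.fst _ _ =
      coprod.map (pullback.fst _ _) (𝟙 _) ≫ coprod.desc (𝟙 _) E.ι := by ext <;> simp [mid]
  have e₂ : coprod.desc (𝟙 _) (mid E F) ≫ pullback.snd _ _ =
      coprod.map (pullback.snd _ _) (𝟙 _) ≫ coprod.desc (𝟙 _) F.κ := by ext <;> simp [mid]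
  have c₁ : flatMap (pullback.fst E.ρ F.σ ≫ E.ρ) (𝟙 G.top) =
      flatMap (pullback.fst E.ρ F.σ) (𝟙 _) ≫ flatMap E.ρ (𝟙 _) := flatMap_comp ..
  have c₂ : flatMap (pullback.fst E.ρ F.σ ≫ E.ρ) (𝟙 G.top) =
      flatMap (pullback.snd E.ρ F.σ) (𝟙 _) ≫ flatMap F.σ (𝟙 _) := by
    rw [pullback.condition, flatMap_comp]
  apply pullback.hom_ext
  · simp only [Category.assoc, e₁, c₁]
    rw [reassoc_of% (flatMap_ι (pullback.fst E.ρ F.σ) (𝟙 G.top)).symm, ← hι]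
    simp [mid]
  · simp only [Category.assoc, e₂, c₂]
    rw [reassoc_of% (flatMap_ι (pullback.snd E.ρ F.σ) (𝟙 G.top)).symm, ← hκ]
    simp [mid]

lemma exists_mid_ext : ∃ (Q : C) (q : pullback E.ρ F.σ ⟶ Q), IsExtension (mid E F) q := by
  obtain ⟨Q, q, hq, hk⟩ := normal_of_conj (mid E F) _ (mid_normal E F)
  exact ⟨Q, q, isExtension_of_regularEpi hk⟩

instance : HasCokernel (mid E F) := by
  obtain ⟨Q, q, -, w, ⟨h⟩⟩ := exists_mid_ext E F
  exact ⟨⟨⟨_, h⟩⟩⟩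

lemma mid_isKernel : IsKernel (mid E F) (cokernel.π (mid E F)) := by
  obtain ⟨Q, q, hk, hc⟩ := exists_mid_ext E F
  refine IsKernel.mk' (cokernel.condition _) fun x hx => hk.fac x ?_
  rw [← cokernel.π_desc (mid E F) q hk.w, ← Category.assoc, hx, zero_comp]

/-- The total object of the composite butterfly: the cokernel of `⟨ι, κ'⟩`. -/
noncomputable def compObj : C := cokernel (mid E F)

/-- The projection `q` from the pullback of `ρ` and `σ'` onto the total object of the composite. -/
noncomputable def compπ : pullback E.ρ F.σ ⟶ compObj E F := cokernel.π (mid E F)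

instance : IsRegularEpi (compπ E F) :=
  inferInstanceAs (IsRegularEpi (coequalizer.π (mid E F) 0))

/-- The morphism out of the total object of the composite induced by a morphism out of the
pullback. -/
noncomputable def compDesc {Z : C} (u : pullback E.ρ F.σ ⟶ Z) (hu : mid E F ≫ u = 0) :
    compObj E F ⟶ Z := cokernel.desc _ u hu

@[simp] lemma compπ_desc {Z : C} (u : pullback E.ρ F.σ ⟶ Z) (hu : mid E F ≫ u = 0) :
    compπ E F ≫ compDesc E F u hu = u := cokernel.π_desc _ _ _

@[simp] lemma compπ_desc_assoc {Z Z' : C} (u : pullback E.ρ F.σ ⟶ Z) (hu : mid E F ≫ u = 0)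
    (z : Z ⟶ Z') : compπ E F ≫ compDesc E F u hu ≫ z = u ≫ z := by
  rw [← Category.assoc, compπ_desc]

@[simp] lemma mid_compπ : mid E F ≫ compπ E F = 0 := cokernel.condition _

/-- The composite of two butterflies `E : H ⟶ G` and `F : G ⟶ K`: the cokernel of
`⟨ι, κ'⟩ : G ⟶ E ×_{G₀} F`, with the induced arrows. -/
noncomputable def comp : Butterfly H K where
  obj := compObj E F
  κ := pullback.lift E.κ (0 : H.top ⟶ F.obj) (by simp) ≫ compπ E F
  ρ := compDesc E F (pullback.snd E.ρ F.σ ≫ F.ρ) (by simp [mid])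
  ι := pullback.lift (0 : K.top ⟶ E.obj) F.ι (by simp) ≫ compπ E F
  σ := compDesc E F (pullback.fst E.ρ F.σ ≫ E.σ) (by simp [mid])
  κ_σ := by simp
  ι_ρ := by simp
  κ_ρ := by simp
  isExtension := by
    set s := compDesc E F (pullback.fst E.ρ F.σ ≫ E.σ) (by simp [mid])
    have hs : compπ E F ≫ s = pullback.fst E.ρ F.σ ≫ E.σ := compπ_desc ..
    set j := pullback.lift (0 : K.top ⟶ E.obj) F.ι (by simp) ≫ compπ E F
    have : IsRegularEpi (pullback.fst E.ρ F.σ ≫ E.σ) := isRegularEpi_comp _ _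
    have : IsRegularEpi s := isRegularEpi_of_comp (compπ E F) s (by rw [hs]; infer_instance)
    refine isExtension_of_regularEpi ?_
    have hw : j ≫ s = 0 := by simp [j, s]
    have hmono : Mono j := by
      refine mono_of_trivial_kernel j fun {T} t ht => ?_
      obtain ⟨y, hy⟩ := (mid_isKernel E F).fac (t ≫ pullback.lift (0 : K.top ⟶ E.obj) F.ι (by simp))
        ((Category.assoc _ _ _).trans ht)
      have hy₁ : y = 0 := by
        rw [← cancel_mono E.ι]
        simpa [mid] using congrArg (· ≫ pullback.fst _ _) hy
      rw [← cancel_mono F.ι]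
      simpa [mid, hy₁] using (congrArg (· ≫ pullback.snd _ _) hy).symm
    have hL := isKernel_kernel s
    set l := kernel.ι s
    obtain ⟨j', hj'⟩ := hL.fac j hw
    have : Mono j' := by
      have : Mono (j' ≫ l) := by rw [hj']; exact hmono
      exact mono_of_mono j' l
    -- the pullback of `q` along the kernel of `s`
    let D := pullback (G.bd) F.σ
    let u : D ⟶ pullback E.ρ F.σ := pullback.lift (pullback.fst _ _ ≫ E.ι) (pullback.snd _ _) (by
      simp [D, pullback.condition])
    have hu : IsKernel u (compπ E F ≫ s) := by
      have : Mono u := by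
        refine ⟨fun a b hab => ?_⟩
        have h₁ := congrArg (· ≫ pullback.fst _ _) hab
        have h₂ := congrArg (· ≫ pullback.snd _ _) hab
        apply pullback.hom_ext
        · rw [← cancel_mono E.ι]
          simpa [u] using h₁
        · simpa [u] using h₂
      refine IsKernel.mk' (by simp [hs, u]) fun x hx => ?_
      obtain ⟨y, hy⟩ := E.isExtension.1.fac (x ≫ pullback.fst _ _) (by simpa [hs] using hx)
      refine ⟨pullback.lift y (x ≫ pullback.snd _ _) ?_, ?_⟩
      · rw [Category.assoc, ← pullback.condition, ← Category.assoc, ← hy]; simp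
      · apply pullback.hom_ext <;> simp [u, hy]
    obtain ⟨r, hr⟩ := hL.fac (u ≫ compπ E F) (by simpa using hu.w)
    have : IsRegularEpi r := isRegularEpi_on_kernels (compπ E F) s hu hL r hr
    have hk := isKernel_pullback_fst G.bd F.isExtension.1
    have : Mono l := hL.mono
    have : IsIso j' := by
      refine point_gen hk (s := pullback.lift (𝟙 _) F.κ (by simp)) (by simp) r j' (𝟙 _) ?_ 0 ?_
      · rw [← cancel_mono l, Category.id_comp, hj', Category.assoc, hr]
        simp only [j, ← Category.assoc]
        congr 1
        apply pullback.hom_ext <;> simp [u]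
      · rw [← cancel_mono l, zero_comp, zero_comp, Category.assoc, hr, ← Category.assoc,
          ← mid_compπ E F]
        congr 1
        apply pullback.hom_ext <;> simp [u, mid]
    refine IsKernel.mk' hw fun x hx => ?_
    obtain ⟨y, hy⟩ := hL.fac x hx
    exact ⟨y ≫ inv j', by rw [← hj', Category.assoc, IsIso.inv_hom_id_assoc, hy]⟩
  precrossed_κ := by
    have := isRegularEpi_flatMap (compπ E F) H.top
    have hκ := E.precrossed_κ
    rw [flatMap_conj_eq] at hκ ⊢
    set s := compDesc E F (pullback.fst E.ρ F.σ ≫ E.σ) (by simp [mid])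
    have hs : compπ E F ≫ s = pullback.fst E.ρ F.σ ≫ E.σ := compπ_desc ..
    set j : H.top ⟶ pullback E.ρ F.σ := pullback.lift E.κ (0 : H.top ⟶ F.obj) (by simp) with hj
    have key : flatMap (pullback.fst E.ρ F.σ) (𝟙 H.top) ≫ flatMap E.σ (𝟙 H.top) ≫
        H.action.act ≫ j = flatι _ _ ≫ coprod.desc (𝟙 _) j := by
      have e₁ : coprod.desc (𝟙 _) j ≫ pullback.fst _ _ =
          coprod.map (pullback.fst _ _) (𝟙 _) ≫ coprod.desc (𝟙 _) E.κ := by ext <;> simp [j]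
      have e₂ : coprod.desc (𝟙 _) j ≫ pullback.snd _ _ =
          coprod.desc (𝟙 _) 0 ≫ pullback.snd _ _ := by ext <;> simp [j]
      apply pullback.hom_ext
      · simp only [Category.assoc, e₁]
        rw [reassoc_of% (flatMap_ι (pullback.fst E.ρ F.σ) (𝟙 H.top)).symm, ← hκ]
        simp [j]
      · simp only [Category.assoc, e₂]
        rw [← Category.assoc (flatι _ _), flatι_comp]
        simp [j]
    have c₁ : flatMap (compπ E F) (𝟙 H.top) ≫ flatMap s (𝟙 H.top) =
        flatMap (pullback.fst E.ρ F.σ) (𝟙 H.top) ≫ flatMap E.σ (𝟙 H.top) := by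
      rw [← flatMap_comp, ← flatMap_comp, hs]
    have e₃ : coprod.map (compπ E F) (𝟙 H.top) ≫ coprod.desc (𝟙 _) (j ≫ compπ E F) =
        coprod.desc (𝟙 _) j ≫ compπ E F := by ext <;> simp
    rw [← cancel_epi (flatMap (compπ E F) (𝟙 H.top)), reassoc_of% c₁, reassoc_of% key,
      flatMap_ι_assoc, e₃]
  precrossed_ι := by
    have := isRegularEpi_flatMap (compπ E F) K.top
    have hι := F.precrossed_ι
    rw [flatMap_conj_eq] at hι ⊢
    set s := compDesc E F (pullback.snd E.ρ F.σ ≫ F.ρ) (by simp [mid])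
    have hs : compπ E F ≫ s = pullback.snd E.ρ F.σ ≫ F.ρ := compπ_desc ..
    set j : K.top ⟶ pullback E.ρ F.σ := pullback.lift (0 : K.top ⟶ E.obj) F.ι (by simp) with hj
    have key : flatMap (pullback.snd E.ρ F.σ) (𝟙 K.top) ≫ flatMap F.ρ (𝟙 K.top) ≫
        K.action.act ≫ j = flatι _ _ ≫ coprod.desc (𝟙 _) j := by
      have e₁ : coprod.desc (𝟙 _) j ≫ pullback.snd _ _ =
          coprod.map (pullback.snd _ _) (𝟙 _) ≫ coprod.desc (𝟙 _) F.ι := by ext <;> simp [j]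
      have e₂ : coprod.desc (𝟙 _) j ≫ pullback.fst _ _ =
          coprod.desc (𝟙 _) 0 ≫ pullback.fst _ _ := by ext <;> simp [j]
      apply pullback.hom_ext
      · simp only [Category.assoc, e₂]
        rw [← Category.assoc (flatι _ _), flatι_comp]
        simp [j]
      · simp only [Category.assoc, e₁]
        rw [reassoc_of% (flatMap_ι (pullback.snd E.ρ F.σ) (𝟙 K.top)).symm, ← hι]
        simp [j]
    have c₁ : flatMap (compπ E F) (𝟙 K.top) ≫ flatMap s (𝟙 K.top) =
        flatMap (pullback.snd E.ρ F.σ) (𝟙 K.top) ≫ flatMap F.ρ (𝟙 K.top) := by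
      rw [← flatMap_comp, ← flatMap_comp, hs]
    have e₃ : coprod.map (compπ E F) (𝟙 K.top) ≫ coprod.desc (𝟙 _) (j ≫ compπ E F) =
        coprod.desc (𝟙 _) j ≫ compπ E F := by ext <;> simp
    rw [← cancel_epi (flatMap (compπ E F) (𝟙 K.top)), reassoc_of% c₁, reassoc_of% key,
      flatMap_ι_assoc, e₃]

end Comp

end Butterfly

namespace Butterfly

section Bicat

attribute [local simp] pullback.lift_fst pullback.lift_fst_assoc pullback.lift_snd
  pullback.lift_snd_assoc prod.lift_fst prod.lift_fst_assoc prod.lift_snd prod.lift_snd_assoc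
  κ_σ ι_ρ κ_ρ ι_σ Hom.κ_hom Hom.hom_ρ Hom.ι_hom Hom.hom_σ

set_option linter.unusedSectionVars false

variable {C : Type u} [Category.{v} C] [HasZeroMorphisms C] [SemiAbelian C]
variable {H G K L : CrossedModule C}

instance : Category.{v} (Butterfly H G) where
  Hom := Hom
  id E := { hom := 𝟙 E.obj, κ_hom := by simp, hom_ρ := by simp, ι_hom := by simp, hom_σ := by simp }
  comp f f' :=
    { hom := f.hom ≫ f'.hom
      κ_hom := by rw [← Category.assoc, f.κ_hom, f'.κ_hom]
      hom_ρ := by rw [Category.assoc, f'.hom_ρ, f.hom_ρ]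
      ι_hom := by rw [← Category.assoc, f.ι_hom, f'.ι_hom]
      hom_σ := by rw [Category.assoc, f'.hom_σ, f.hom_σ] }
  id_comp _ := Hom.ext (Category.id_comp _)
  comp_id _ := Hom.ext (Category.comp_id _)
  assoc _ _ _ := Hom.ext (Category.assoc _ _ _)

@[simp] lemma id_hom (E : Butterfly H G) : Hom.hom (𝟙 E) = 𝟙 E.obj := rfl
@[simp] lemma comp_hom {E E' E'' : Butterfly H G} (f : E ⟶ E') (f' : E' ⟶ E'') :
    Hom.hom (f ≫ f') = Hom.hom f ≫ Hom.hom f' := rfl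

lemma hom_ext' {E E' : Butterfly H G} {f f' : E ⟶ E'} (h : Hom.hom f = Hom.hom f') : f = f' :=
  Hom.ext h

lemma isIso_hom {E E' : Butterfly H G} (f : Hom E E') : IsIso f.hom := by
  have : Mono f.hom := by
    refine mono_of_trivial_kernel _ fun {T} t ht => ?_
    obtain ⟨y, hy⟩ := E.isExtension.1.fac t (by
      rw [← f.hom_σ, ← Category.assoc, ht, zero_comp])
    have hy0 : y = 0 := by
      rw [← cancel_mono E'.ι, ← f.ι_hom, ← Category.assoc, hy, ht, zero_comp]
    rw [← hy, hy0, zero_comp]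
  exact point_gen (isKernel_pullback_fst E.σ E'.isExtension.1)
    (s := pullback.lift (𝟙 _) f.hom (by simp)) (by simp) (pullback.snd _ _) f.hom E.ι (by simp)
    (𝟙 _) (by simp)

instance {E E' : Butterfly H G} (f : E ⟶ E') : IsIso f := by
  have := isIso_hom f
  refine ⟨{ hom := inv (Hom.hom f), κ_hom := ?_, hom_ρ := ?_, ι_hom := ?_, hom_σ := ?_ },
    hom_ext' (IsIso.hom_inv_id _), hom_ext' (IsIso.inv_hom_id _)⟩
  · rw [IsIso.comp_inv_eq, Hom.κ_hom]
  · rw [IsIso.inv_comp_eq, Hom.hom_ρ]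
  · rw [IsIso.comp_inv_eq, Hom.ι_hom]
  · rw [IsIso.inv_comp_eq, Hom.hom_σ]

section Mk

variable (E : Butterfly H G) (F : Butterfly G K)

/-- The projection `q` onto the total object of the composite. -/
noncomputable def proj : pullback E.ρ F.σ ⟶ (comp E F).obj := compπ E F

instance : IsRegularEpi (proj E F) := inferInstanceAs (IsRegularEpi (compπ E F))

/-- The morphism induced by a morphism out of the pullback. -/
noncomputable def desc {Z : C} (u : pullback E.ρ F.σ ⟶ Z) (hu : mid E F ≫ u = 0) :
    (comp E F).obj ⟶ Z := compDesc E F u hu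

@[simp] lemma proj_desc {Z : C} (u : pullback E.ρ F.σ ⟶ Z) (hu : mid E F ≫ u = 0) :
    proj E F ≫ desc E F u hu = u := compπ_desc E F u hu

@[simp] lemma proj_desc_assoc {Z Z' : C} (u : pullback E.ρ F.σ ⟶ Z) (hu : mid E F ≫ u = 0)
    (z : Z ⟶ Z') : proj E F ≫ desc E F u hu ≫ z = u ≫ z := compπ_desc_assoc E F u hu z

@[simp] lemma mid_proj : mid E F ≫ proj E F = 0 := mid_compπ E F

@[simp] lemma proj_σ : proj E F ≫ (comp E F).σ = pullback.fst _ _ ≫ E.σ := compπ_desc ..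

@[simp] lemma proj_ρ : proj E F ≫ (comp E F).ρ = pullback.snd _ _ ≫ F.ρ := compπ_desc ..

lemma mid_isKernel_proj : IsKernel (mid E F) (proj E F) := mid_isKernel E F

/-- The generalized element of the composite butterfly represented by a pair. -/
noncomputable def pair {T : C} (x : T ⟶ E.obj) (y : T ⟶ F.obj) (h : x ≫ E.ρ = y ≫ F.σ) :
    T ⟶ (comp E F).obj := pullback.lift x y h ≫ proj E F

variable {E F}

lemma precomp_pair {T S : C} (s : S ⟶ T) (x : T ⟶ E.obj) (y : T ⟶ F.obj)
    (h : x ≫ E.ρ = y ≫ F.σ) :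
    s ≫ pair E F x y h = pair E F (s ≫ x) (s ≫ y) (by simp [h]) := by
  rw [pair, pair, ← Category.assoc]
  congr 1
  apply pullback.hom_ext <;> simp

@[simp] lemma pair_σ {T : C} (x : T ⟶ E.obj) (y : T ⟶ F.obj) (h : x ≫ E.ρ = y ≫ F.σ) :
    pair E F x y h ≫ (comp E F).σ = x ≫ E.σ := by simp [pair]

@[simp] lemma pair_ρ {T : C} (x : T ⟶ E.obj) (y : T ⟶ F.obj) (h : x ≫ E.ρ = y ≫ F.σ) :
    pair E F x y h ≫ (comp E F).ρ = y ≫ F.ρ := by simp [pair]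

lemma comp_κ : (comp E F).κ = pair E F E.κ 0 (by simp) := rfl
lemma comp_ι : (comp E F).ι = pair E F 0 F.ι (by simp) := rfl

@[simp] lemma pair_zero {T : C} : pair E F (0 : T ⟶ _) 0 (by simp) = 0 := by
  have : pullback.lift (0 : T ⟶ E.obj) (0 : T ⟶ F.obj) (by simp) = (0 : T ⟶ pullback E.ρ F.σ) := by
    apply pullback.hom_ext <;> simp
  rw [pair, this, zero_comp]

lemma pair_mid : pair E F E.ι F.κ (by simp) = 0 := mid_proj E F

lemma pair_cover {T : C} (t : T ⟶ (comp E F).obj) : ∃ (T' : C) (c : T' ⟶ T) (_ : Epi c)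
    (x : T' ⟶ E.obj) (y : T' ⟶ F.obj) (h : x ≫ E.ρ = y ≫ F.σ), c ≫ t = pair E F x y h := by
  obtain ⟨T', c, hc, z, hz⟩ := covering (proj E F) t
  refine ⟨T', c, inferInstance, z ≫ pullback.fst _ _, z ≫ pullback.snd _ _,
    by simp [pullback.condition], ?_⟩
  rw [hz, pair]
  congr 1
  apply pullback.hom_ext <;> simp

lemma pair_hom_ext {Z : C} {f g : (comp E F).obj ⟶ Z}
    (h : ∀ {T : C} (x : T ⟶ E.obj) (y : T ⟶ F.obj) (h : x ≫ E.ρ = y ≫ F.σ),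
      pair E F x y h ≫ f = pair E F x y h ≫ g) : f = g := by
  obtain ⟨T', c, hc, x, y, hxy, e⟩ := pair_cover (𝟙 (comp E F).obj)
  rw [Category.comp_id] at e
  rw [← cancel_epi c, e, h]

/-- Morphisms out of the composite from morphisms out of the pullback. -/
lemma exists_desc {Z : C} (u : pullback E.ρ F.σ ⟶ Z) (hu : mid E F ≫ u = 0) :
    ∃ w : (comp E F).obj ⟶ Z, ∀ {T : C} (x : T ⟶ E.obj) (y : T ⟶ F.obj)
      (h : x ≫ E.ρ = y ≫ F.σ), pair E F x y h ≫ w = pullback.lift x y h ≫ u :=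
  ⟨desc E F u hu, fun x y h => by simp [pair]⟩

end Mk

/-- Horizontal composition with 2-cells on both sides. -/
noncomputable def map₂ {E E' : Butterfly H G} {F F' : Butterfly G K} (η : Hom E E')
    (θ : Hom F F') : Hom (comp E F) (comp E' F') where
  hom := desc E F (pair E' F' (pullback.fst _ _ ≫ η.hom) (pullback.snd _ _ ≫ θ.hom)
    (by simp [pullback.condition])) (by
      rw [precomp_pair, ← pair_mid]
      congr 1 <;> simp [mid])
  κ_hom := by
    rw [comp_κ, comp_κ, pair, Category.assoc, proj_desc, precomp_pair]
    congr 1 <;> simp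
  ι_hom := by
    rw [comp_ι, comp_ι, pair, Category.assoc, proj_desc, precomp_pair]
    congr 1 <;> simp
  hom_ρ := by
    apply pair_hom_ext
    intro T x y h
    rw [pair, Category.assoc, proj_desc_assoc, pair_ρ, ← pair, pair_ρ]
    simp
  hom_σ := by
    apply pair_hom_ext
    intro T x y h
    rw [pair, Category.assoc, proj_desc_assoc, pair_σ, ← pair, pair_σ]
    simp

lemma pair_map₂ {E E' : Butterfly H G} {F F' : Butterfly G K} (η : Hom E E') (θ : Hom F F')
    {T : C} (x : T ⟶ E.obj) (y : T ⟶ F.obj) (h : x ≫ E.ρ = y ≫ F.σ) :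
    pair E F x y h ≫ (map₂ η θ).hom = pair E' F' (x ≫ η.hom) (y ≫ θ.hom) (by simp [h]) := by
  rw [pair, Category.assoc, map₂, proj_desc, precomp_pair]
  congr 1 <;> simp

lemma exists_associator (E : Butterfly H G) (F : Butterfly G K) (D : Butterfly K L) :
    ∃ α : Hom (comp (comp E F) D) (comp E (comp F D)),
      ∀ {T : C} (x : T ⟶ E.obj) (y : T ⟶ F.obj) (z : T ⟶ D.obj) (h : x ≫ E.ρ = y ≫ F.σ)
        (h' : y ≫ F.ρ = z ≫ D.σ),
        pair (comp E F) D (pair E F x y h) z (by simp [h']) ≫ α.hom =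
          pair E (comp F D) x (pair F D y z h') (by simp [h]) := by
  let P := pullback (comp E F).ρ D.σ
  let P₃ := pullback (pullback.snd E.ρ F.σ ≫ F.ρ) D.σ
  let r : P₃ ⟶ P := pullback.lift (pullback.fst _ _ ≫ proj E F) (pullback.snd _ _) (by
    simp [pullback.condition])
  have hr : IsRegularEpi r := by
    let z : pullback (pullback.fst (comp E F).ρ D.σ) (proj E F) ⟶ P₃ :=
      pullback.lift (pullback.snd _ _) (pullback.fst _ _ ≫ pullback.snd _ _) (by
        have : proj E F ≫ (comp E F).ρ = pullback.snd E.ρ F.σ ≫ F.ρ := proj_ρ E F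
        rw [Category.assoc, ← pullback.condition, ← this, pullback.condition_assoc])
    have e : z ≫ r = pullback.fst _ _ := by
      apply pullback.hom_ext <;> simp [z, r, pullback.condition]
    exact isRegularEpi_of_comp z r (by rw [e]; infer_instance)
  have hn : IsKernel (pullback.lift (mid E F) (0 : G.top ⟶ D.obj) (by simp [mid])) r := by
    have : Mono (pullback.lift (mid E F) (0 : G.top ⟶ D.obj) (by simp [mid]) : G.top ⟶ P₃) :=
      mono_of_mono_fac (pullback.lift_fst (mid E F) (0 : G.top ⟶ D.obj) (by simp [mid]))
    refine IsKernel.mk' (by apply pullback.hom_ext <;> simp [r]) fun x hx => ?_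
    obtain ⟨y, hy⟩ := (mid_isKernel_proj E F).fac (x ≫ pullback.fst _ _) (by
      simpa [r] using congrArg (· ≫ pullback.fst _ _) hx)
    refine ⟨y, pullback.hom_ext (by simp [hy]) ?_⟩
    simpa [r] using (congrArg (· ≫ pullback.snd _ _) hx).symm
  obtain ⟨u, hu⟩ := (isCokernel_of_regularEpi hn).fac
    (pair E (comp F D) (pullback.fst _ _ ≫ pullback.fst _ _)
      (pair F D (pullback.fst _ _ ≫ pullback.snd _ _) (pullback.snd _ _) (by
        simp [pullback.condition])) (by simp [pullback.condition])) (by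
      rw [precomp_pair, ← pair_mid]
      congr 1
      · simp [mid]
      · rw [precomp_pair, comp_κ]
        congr 1 <;> simp [mid])
  have hu' : ∀ {T : C} (x : T ⟶ E.obj) (y : T ⟶ F.obj) (z : T ⟶ D.obj) (h : x ≫ E.ρ = y ≫ F.σ)
      (h' : y ≫ F.ρ = z ≫ D.σ), pullback.lift (pair E F x y h) z (by simp [h']) ≫ u =
          pair E (comp F D) x (pair F D y z h') (by simp [h]) := by
    intro T x y z h h'
    have : pullback.lift (pair E F x y h) z (by simp [h']) =
        pullback.lift (pullback.lift x y h) z (by simp [h']) ≫ r := by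
      apply pullback.hom_ext <;> simp [r, pair]
    rw [this, Category.assoc, hu, precomp_pair]
    congr 1
    · simp
    · rw [precomp_pair]
      congr 1 <;> simp
  obtain ⟨w, hw⟩ := exists_desc (E := comp E F) (F := D) u (by
    have : mid (comp E F) D = pullback.lift (pair E F 0 F.ι (by simp)) D.κ (by simp) := rfl
    rw [this, hu', ← pair_zero]
    congr 1
    exact pair_mid)
  have hw' : ∀ {T : C} (x : T ⟶ E.obj) (y : T ⟶ F.obj) (z : T ⟶ D.obj) (h : x ≫ E.ρ = y ≫ F.σ)
      (h' : y ≫ F.ρ = z ≫ D.σ),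
      pair (comp E F) D (pair E F x y h) z (by simp [h']) ≫ w =
          pair E (comp F D) x (pair F D y z h') (by simp [h]) := fun x y z h h' => by
    rw [hw, hu']
  have ext : ∀ {Z : C} {f g : (comp (comp E F) D).obj ⟶ Z}, 
      (∀ {T : C} (x : T ⟶ E.obj) (y : T ⟶ F.obj) (z : T ⟶ D.obj) (h : x ≫ E.ρ = y ≫ F.σ)
      (h' : y ≫ F.ρ = z ≫ D.σ), pair (comp E F) D (pair E F x y h) z (by simp [h']) ≫ f =
        pair (comp E F) D (pair E F x y h) z (by simp [h']) ≫ g) → f = g := by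
    intro Z f g hfg
    apply pair_hom_ext
    intro T t z h
    obtain ⟨T', c, hc, x, y, hxy, e⟩ := pair_cover t
    rw [← cancel_epi c, ← Category.assoc, ← Category.assoc, precomp_pair]
    simp only [e]
    exact hfg x y (c ≫ z) hxy (by
      rw [← pair_ρ x y hxy, ← e, Category.assoc, h, Category.assoc])
  refine ⟨⟨w, ?_, ?_, ?_, ?_⟩, hw'⟩
  · have : (comp (comp E F) D).κ = pair (comp E F) D (pair E F E.κ 0 (by simp)) 0 (by simp) := rfl
    rw [this, hw' E.κ 0 0 (by simp) (by simp), comp_κ]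
    congr 1
    simp
  · apply ext
    intro T x y z h h'
    rw [← Category.assoc, hw' x y z h h']; simp
  · have : (comp (comp E F) D).ι = pair (comp E F) D (pair E F 0 0 (by simp)) D.ι (by simp) := by
      rw [comp_ι]; congr 1; simp
    rw [this, hw' 0 0 D.ι (by simp) (by simp), comp_ι]
    rfl
  · apply ext
    intro T x y z h h'
    rw [← Category.assoc, hw' x y z h h']; simp

/-- The associativity constraint: it sends `((x, y), z)` to `(x, (y, z))`. -/
noncomputable def assocHom (E : Butterfly H G) (F : Butterfly G K) (D : Butterfly K L) :
    Hom (comp (comp E F) D) (comp E (comp F D)) := (exists_associator E F D).choose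

lemma pair_assocHom (E : Butterfly H G) (F : Butterfly G K) (D : Butterfly K L)
    {T : C} (x : T ⟶ E.obj) (y : T ⟶ F.obj) (z : T ⟶ D.obj) (h : x ≫ E.ρ = y ≫ F.σ)
    (h' : y ≫ F.ρ = z ≫ D.σ) :
    pair (comp E F) D (pair E F x y h) z (by simp [h']) ≫ (assocHom E F D).hom =
      pair E (comp F D) x (pair F D y z h') (by simp [h]) :=
  (exists_associator E F D).choose_spec x y z h h'

variable [HuqSmith C]

/-- The unit section `G₀ ⟶ G₁`, as a morphism into the identity butterfly. -/
noncomputable def idE (G : CrossedModule C) : G.base ⟶ (id G).obj := G.e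

/-- The division morphism, as a morphism into the identity butterfly. -/
noncomputable def idDiv (G : CrossedModule C) : G.top ⨯ G.top ⟶ (id G).obj := G.division

@[simp] lemma idE_σ : idE G ≫ (id G).σ = 𝟙 _ := G.e_c
@[simp] lemma idE_ρ : idE G ≫ (id G).ρ = 𝟙 _ := G.e_d
lemma idDiv_σ : idDiv G ≫ (id G).σ = prod.snd ≫ G.bd := G.division_c
lemma idDiv_ρ : idDiv G ≫ (id G).ρ = prod.fst ≫ G.bd := G.division_d
@[simp] lemma inl_idDiv : prod.lift (𝟙 _) 0 ≫ idDiv G = (id G).ι := G.inl_division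
@[simp] lemma inr_idDiv : prod.lift 0 (𝟙 _) ≫ idDiv G = (id G).κ := rfl
@[simp] lemma diag_idDiv : prod.lift (𝟙 _) (𝟙 _) ≫ idDiv G = G.bd ≫ idE G := G.diag_division

/-- The inverse of the left unit constraint: it sends `x` to `(e (σ x), x)`. -/
noncomputable def leftUnitInv (E : Butterfly H G) : Hom E (comp (id H) E) where
  hom := pair (id H) E (E.σ ≫ idE H) (𝟙 _) (by simp)
  κ_hom := by
    have key : pair (id H) E (idDiv H) (prod.fst ≫ E.κ) (by simp [idDiv_ρ]) =
        prod.snd ≫ (comp (id H) E).κ := by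
      apply CrossedModule.prod_ext
      · rw [precomp_pair, prod.lift_snd_assoc, zero_comp, ← pair_mid]
        congr 1
        · simp
        · simp
      · rw [precomp_pair, prod.lift_snd_assoc, Category.id_comp, comp_κ]
        congr 1
        · simp
    have := congrArg (prod.lift (𝟙 _) (𝟙 _) ≫ ·) key
    simp only [precomp_pair, prod.lift_snd_assoc, prod.lift_fst_assoc, Category.id_comp,
      diag_idDiv] at this
    rw [← this, precomp_pair]
    congr 1
    · simp [reassoc_of% E.κ_σ]
    · simp
  hom_ρ := by simp
  ι_hom := by
    rw [precomp_pair, comp_ι]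
    congr 1
    · rw [← Category.assoc, ι_σ, zero_comp]
    · simp
  hom_σ := by simp

/-- The inverse of the right unit constraint: it sends `x` to `(x, e (ρ x))`. -/
noncomputable def rightUnitInv (E : Butterfly H G) : Hom E (comp E (id G)) where
  hom := pair E (id G) (𝟙 _) (E.ρ ≫ idE G) (by simp)
  κ_hom := by
    rw [precomp_pair, comp_κ]
    congr 1
    · simp
    · rw [← Category.assoc, κ_ρ, zero_comp]
  hom_ρ := by simp
  ι_hom := by
    have key : pair E (id G) (prod.snd ≫ E.ι) (idDiv G) (by simp [idDiv_σ]) =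
        prod.fst ≫ (comp E (id G)).ι := by
      apply CrossedModule.prod_ext
      · rw [precomp_pair, prod.lift_fst_assoc, Category.id_comp, comp_ι]
        congr 1
        · simp
        · simp
      · rw [precomp_pair, prod.lift_fst_assoc, zero_comp, ← pair_mid]
        congr 1
        · simp
    have := congrArg (prod.lift (𝟙 _) (𝟙 _) ≫ ·) key
    simp only [precomp_pair, prod.lift_snd_assoc, prod.lift_fst_assoc, Category.id_comp,
      diag_idDiv] at this
    rw [← this, precomp_pair]
    congr 1
    · simp
    · simp [reassoc_of% E.ι_ρ]
  hom_σ := by simp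

end Bicat
end Butterfly

namespace Butterfly

section Coherence

attribute [local simp] pullback.lift_fst pullback.lift_fst_assoc pullback.lift_snd
  pullback.lift_snd_assoc prod.lift_fst prod.lift_fst_assoc prod.lift_snd prod.lift_snd_assoc
  κ_σ ι_ρ κ_ρ ι_σ Hom.κ_hom Hom.hom_ρ Hom.ι_hom Hom.hom_σ

variable {C : Type u} [Category.{v} C] [HasZeroMorphisms C] [SemiAbelian C]
variable {H G K L M : CrossedModule C}

lemma pair_congr {E : Butterfly H G} {F : Butterfly G K} {T : C} {x x' : T ⟶ E.obj}
    {y y' : T ⟶ F.obj} {h : x ≫ E.ρ = y ≫ F.σ} {h' : x' ≫ E.ρ = y' ≫ F.σ} (hx : x = x')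
    (hy : y = y') : pair E F x y h = pair E F x' y' h' := by
  subst hx hy; rfl

lemma pair_hom_ext₃ {E : Butterfly H G} {F : Butterfly G K} {D : Butterfly K L} {Z : C}
    {f g : (comp (comp E F) D).obj ⟶ Z}
    (hfg : ∀ {T : C} (x : T ⟶ E.obj) (y : T ⟶ F.obj) (z : T ⟶ D.obj) (h : x ≫ E.ρ = y ≫ F.σ)
      (h' : y ≫ F.ρ = z ≫ D.σ), pair (comp E F) D (pair E F x y h) z (by simp [h']) ≫ f =
        pair (comp E F) D (pair E F x y h) z (by simp [h']) ≫ g) : f = g := by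
  apply pair_hom_ext
  intro T t z h
  obtain ⟨T', c, hc, x, y, hxy, e⟩ := pair_cover t
  have hz : y ≫ F.ρ = (c ≫ z) ≫ D.σ := by
    rw [← pair_ρ x y hxy, ← e, Category.assoc, h, Category.assoc]
  have key : c ≫ pair (comp E F) D t z h =
      pair (comp E F) D (pair E F x y hxy) (c ≫ z) (by simp [hz]) := by
    rw [precomp_pair]; exact pair_congr e rfl
  rw [← cancel_epi c, ← Category.assoc, ← Category.assoc, key]
  exact hfg x y (c ≫ z) hxy hz

lemma pair_hom_ext₄ {E : Butterfly H G} {F : Butterfly G K} {D : Butterfly K L}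
    {B : Butterfly L M} {Z : C} {f g : (comp (comp (comp E F) D) B).obj ⟶ Z}
    (hfg : ∀ {T : C} (x : T ⟶ E.obj) (y : T ⟶ F.obj) (z : T ⟶ D.obj) (w : T ⟶ B.obj)
      (h : x ≫ E.ρ = y ≫ F.σ) (h' : y ≫ F.ρ = z ≫ D.σ) (h'' : z ≫ D.ρ = w ≫ B.σ),
      pair (comp (comp E F) D) B (pair (comp E F) D (pair E F x y h) z (by simp [h'])) w
          (by simp [h'']) ≫ f =
        pair (comp (comp E F) D) B (pair (comp E F) D (pair E F x y h) z (by simp [h'])) w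
          (by simp [h'']) ≫ g) : f = g := by
  apply pair_hom_ext₃
  intro T t z w h h'
  obtain ⟨T', c, hc, x, y, hxy, e⟩ := pair_cover t
  have hz : y ≫ F.ρ = (c ≫ z) ≫ D.σ := by
    rw [← pair_ρ x y hxy, ← e, Category.assoc, h, Category.assoc]
  have hw : (c ≫ z) ≫ D.ρ = (c ≫ w) ≫ B.σ := by simp [h']
  have key : c ≫ pair (comp (comp E F) D) B (pair (comp E F) D t z h) w (by simp [h']) =
      pair (comp (comp E F) D) B (pair (comp E F) D (pair E F x y hxy) (c ≫ z) (by simp [hz]))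
        (c ≫ w) (by simp [h']) := by
    rw [precomp_pair]
    refine pair_congr ?_ rfl
    rw [precomp_pair]
    exact pair_congr e rfl
  rw [← cancel_epi c, ← Category.assoc, ← Category.assoc, key]
  exact hfg x y (c ≫ z) (c ≫ w) hxy hz hw

/-- Horizontal composition of 2-cells, as a morphism in the hom-category. -/
noncomputable def hcomp {E E' : Butterfly H G} {F F' : Butterfly G K} (η : E ⟶ E')
    (θ : F ⟶ F') : comp E F ⟶ comp E' F' := map₂ η θ

lemma pair_hcomp {E E' : Butterfly H G} {F F' : Butterfly G K} (η : E ⟶ E') (θ : F ⟶ F')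
    {T : C} (x : T ⟶ E.obj) (y : T ⟶ F.obj) (h : x ≫ E.ρ = y ≫ F.σ) :
    pair E F x y h ≫ Hom.hom (hcomp η θ) =
      pair E' F' (x ≫ Hom.hom η) (y ≫ Hom.hom θ) (by simp [h]) := pair_map₂ η θ x y h

lemma hcomp_id (E : Butterfly H G) (F : Butterfly G K) : hcomp (𝟙 E) (𝟙 F) = 𝟙 (comp E F) := by
  apply hom_ext'
  apply pair_hom_ext
  intro T x y h
  rw [pair_hcomp]
  exact (pair_congr (h' := h) (by simp) (by simp)).trans (Category.comp_id _).symm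

lemma hcomp_comp {E E' E'' : Butterfly H G} {F F' F'' : Butterfly G K} (η : E ⟶ E')
    (η' : E' ⟶ E'') (θ : F ⟶ F') (θ' : F' ⟶ F'') :
    hcomp (η ≫ η') (θ ≫ θ') = hcomp η θ ≫ hcomp η' θ' := by
  apply hom_ext'
  apply pair_hom_ext
  intro T x y h
  rw [comp_hom (hcomp η θ), ← Category.assoc, pair_hcomp, pair_hcomp, pair_hcomp]
  exact pair_congr (by simp) (by simp)

/-- The associativity constraint. -/
noncomputable def associator (E : Butterfly H G) (F : Butterfly G K) (D : Butterfly K L) :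
    comp (comp E F) D ≅ comp E (comp F D) :=
  @asIso _ _ (comp (comp E F) D) (comp E (comp F D)) (assocHom E F D) inferInstance

lemma pair_associator (E : Butterfly H G) (F : Butterfly G K) (D : Butterfly K L)
    {T : C} (x : T ⟶ E.obj) (y : T ⟶ F.obj) (z : T ⟶ D.obj) (h : x ≫ E.ρ = y ≫ F.σ)
    (h' : y ≫ F.ρ = z ≫ D.σ) :
    pair (comp E F) D (pair E F x y h) z (by simp [h']) ≫ Hom.hom (associator E F D).hom =
      pair E (comp F D) x (pair F D y z h') (by simp [h]) := pair_assocHom E F D x y z h h'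

lemma associator_naturality {E E' : Butterfly H G} {F F' : Butterfly G K} {D D' : Butterfly K L}
    (η : E ⟶ E') (θ : F ⟶ F') (ζ : D ⟶ D') :
    hcomp (hcomp η θ) ζ ≫ (associator E' F' D').hom =
      (associator E F D).hom ≫ hcomp η (hcomp θ ζ) := by
  apply hom_ext'
  apply pair_hom_ext₃
  intro T x y z h h'
  have e₁ : pair (comp E F) D (pair E F x y h) z (by simp [h']) ≫ Hom.hom (hcomp (hcomp η θ) ζ) =
      pair (comp E' F') D' (pair E' F' (x ≫ Hom.hom η) (y ≫ Hom.hom θ) (by simp [h]))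
        (z ≫ Hom.hom ζ) (by simp [h']) := by
    rw [pair_hcomp]
    exact pair_congr (pair_hcomp ..) rfl
  rw [comp_hom, comp_hom, ← Category.assoc, ← Category.assoc, e₁, pair_associator _ _ _ _ _ _ _
    (by simp [h']), pair_associator _ _ _ _ _ _ _ h', pair_hcomp]
  exact pair_congr rfl (pair_hcomp ..).symm

lemma pentagon (E : Butterfly H G) (F : Butterfly G K) (D : Butterfly K L) (B : Butterfly L M) :
    hcomp (associator E F D).hom (𝟙 B) ≫ (associator E (comp F D) B).hom ≫
      hcomp (𝟙 E) (associator F D B).hom =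
      (associator (comp E F) D B).hom ≫ (associator E F (comp D B)).hom := by
  apply hom_ext'
  apply pair_hom_ext₄
  intro T x y z w h h' h''
  have e₁ : pair (comp (comp E F) D) B (pair (comp E F) D (pair E F x y h) z (by simp [h'])) w
          (by simp [h'']) ≫ Hom.hom (hcomp (associator E F D).hom (𝟙 B)) =
      pair (comp E (comp F D)) B (pair E (comp F D) x (pair F D y z h') (by simp [h])) w
        (by simp [h'']) := by
    rw [pair_hcomp]
    exact pair_congr (pair_associator _ _ _ _ _ _ _ h') (by simp)
  simp only [comp_hom, ← Category.assoc]
  rw [e₁, pair_associator E (comp F D) B _ _ _ _ (by simp [h'']), pair_hcomp,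
    pair_associator (comp E F) D B _ _ _ _ h'', pair_associator E F (comp D B) _ _ _ _ (by simp [h'])]
  exact pair_congr (by simp) (pair_associator _ _ _ _ _ _ _ h'')

variable [HuqSmith C]

/-- The left unit constraint. -/
noncomputable def leftUnitor (E : Butterfly H G) : comp (id H) E ≅ E :=
  (@asIso _ _ E (comp (id H) E) (leftUnitInv E) inferInstance).symm

/-- The right unit constraint. -/
noncomputable def rightUnitor (E : Butterfly H G) : comp E (id G) ≅ E :=
  (@asIso _ _ E (comp E (id G)) (rightUnitInv E) inferInstance).symm

lemma leftUnitor_inv_hom (E : Butterfly H G) :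
    Hom.hom (leftUnitor E).inv = pair (id H) E (E.σ ≫ idE H) (𝟙 _) (by simp) := rfl

lemma rightUnitor_inv_hom (E : Butterfly H G) :
    Hom.hom (rightUnitor E).inv = pair E (id G) (𝟙 _) (E.ρ ≫ idE G) (by simp) := rfl

lemma leftUnitor_naturality {E E' : Butterfly H G} (η : E ⟶ E') :
    (leftUnitor E).inv ≫ hcomp (𝟙 (id H)) η = η ≫ (leftUnitor E').inv := by
  apply hom_ext'
  rw [comp_hom, comp_hom, leftUnitor_inv_hom, leftUnitor_inv_hom, pair_hcomp, precomp_pair]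
  exact pair_congr (by simp [← Category.assoc]) (by simp)

lemma rightUnitor_naturality {E E' : Butterfly H G} (η : E ⟶ E') :
    (rightUnitor E).inv ≫ hcomp η (𝟙 (id G)) = η ≫ (rightUnitor E').inv := by
  apply hom_ext'
  rw [comp_hom, comp_hom, rightUnitor_inv_hom, rightUnitor_inv_hom, pair_hcomp, precomp_pair]
  exact pair_congr (by simp) (by simp [← Category.assoc])

lemma triangle (E : Butterfly H G) (F : Butterfly G K) :
    hcomp (rightUnitor E).inv (𝟙 F) ≫ (associator E (id G) F).hom =
      hcomp (𝟙 E) (leftUnitor F).inv := by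
  apply hom_ext'
  apply pair_hom_ext
  intro T x y h
  have e₁ : pair E F x y h ≫ Hom.hom (hcomp (rightUnitor E).inv (𝟙 F)) =
      pair (comp E (id G)) F (pair E (id G) x (x ≫ E.ρ ≫ idE G) (by simp)) y (by simp [h]) := by
    rw [pair_hcomp]
    refine pair_congr ?_ (by simp)
    rw [rightUnitor_inv_hom, precomp_pair]
    exact pair_congr (by simp) rfl
  rw [comp_hom, ← Category.assoc, e₁, pair_associator _ _ _ _ _ _ _ (by simp [h]), pair_hcomp]
  refine pair_congr (by simp) ?_
  rw [leftUnitor_inv_hom, precomp_pair]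
  exact pair_congr (by rw [← Category.assoc, h, Category.assoc]) (by simp)

end Coherence
end Butterfly

section Bicat

variable {C : Type u} [Category.{v} C] [HasZeroMorphisms C] [SemiAbelian C] [HuqSmith C]

open Butterfly in
/-- The bicategory of butterflies: its objects are the crossed modules in `C`, its 1-cells are the
butterflies, and its 2-cells are the morphisms of butterflies. -/
noncomputable instance : Bicategory.{v, max u v} (CrossedModule C) where
  Hom H G := Butterfly H G
  id H := Butterfly.id H
  comp E F := Butterfly.comp E F
  homCategory _ _ := inferInstance
  whiskerLeft E _ _ η := hcomp (𝟙 E) η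
  whiskerRight η F := hcomp η (𝟙 F)
  associator := Butterfly.associator
  leftUnitor := Butterfly.leftUnitor
  rightUnitor := Butterfly.rightUnitor
  whiskerLeft_id _ _ := hcomp_id _ _
  whiskerLeft_comp E _ _ _ η θ := by
    simpa using hcomp_comp (𝟙 E) (𝟙 E) η θ
  id_whiskerLeft η := by
    rw [← Iso.inv_comp_eq]; exact leftUnitor_naturality η
  comp_whiskerLeft E F _ _ η := by
    rw [← Category.assoc, Iso.eq_comp_inv, ← hcomp_id]; exact associator_naturality _ _ _
  id_whiskerRight _ _ := hcomp_id _ _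
  comp_whiskerRight η θ F := by
    simpa using hcomp_comp η θ (𝟙 F) (𝟙 F)
  whiskerRight_id η := by
    rw [← Iso.inv_comp_eq]; exact rightUnitor_naturality η
  whiskerRight_comp η F D := by
    rw [Iso.eq_inv_comp, ← hcomp_id]; exact (associator_naturality _ _ _).symm
  whisker_assoc E _ _ η D := by
    rw [← Category.assoc, Iso.eq_comp_inv]; exact associator_naturality _ _ _
  whisker_exchange η θ := by
    rw [← hcomp_comp, ← hcomp_comp]; simp
  pentagon E F D B := Butterfly.pentagon E F D B
  triangle E F := by
    have h := Butterfly.triangle E F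
    have h₁ : hcomp (𝟙 E) (Butterfly.leftUnitor F).inv ≫
        hcomp (𝟙 E) (Butterfly.leftUnitor F).hom = 𝟙 _ := by
      rw [← hcomp_comp, Iso.inv_hom_id, Category.comp_id, hcomp_id]
    have h₂ : hcomp (Butterfly.rightUnitor E).hom (𝟙 F) ≫
        hcomp (Butterfly.rightUnitor E).inv (𝟙 F) = 𝟙 _ := by
      rw [← hcomp_comp, Iso.hom_inv_id, Category.comp_id, hcomp_id]
    rw [← Category.comp_id (hcomp (Butterfly.rightUnitor E).hom (𝟙 F)), ← h₁, ← h,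
      Category.assoc, reassoc_of% h₂]

end Bicat

end SemiAb

/-!
Write `E*` for the flipped butterfly. Every 2-cell of the bicategory of butterflies is invertible
(a short five lemma), and any pair of invertible 2-cells `𝟙 ≅ E ≫ E*` and `E* ≫ E ≅ 𝟙` can be
corrected to an adjoint equivalence. Flipping twice gives back `E`, so a single 2-cell
`E ≫ E* ⟶ 𝟙`, constructed for every flippable butterfly
(`Butterfly.nonempty_hom_comp_flip`), suffices: its inverse is the unit, and the same construction
applied to `E*` provides the counit.

The total object of `E ≫ E*` is the quotient of the kernel pair of `ρ` by the diagonal copy of `G`.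
Since `κ` is a kernel of `ρ`, a pair `(x, y)` with `ρ x = ρ y` has the form `y = κ h · x`, and the
2-cell sends it to the arrow `g h · e (σ x)` of the groupoid of `H`, which has codomain `σ x` and
domain `σ y`. Formally, the kernel pair is a point over `E` split by the diagonal, with kernel
`⟨0, κ⟩ : H ⟶ Eq ρ`; condition (iii) on butterflies identifies the conjugation action of this point
with the action of `E` on `H` through `σ`, so the universal property of the semidirect product
yields the morphism (`Butterfly.exists_kernelPair_desc`).
-/

namespace SemiAb
namespace Butterfly

attribute [local simp] pullback.lift_fst pullback.lift_fst_assoc pullback.lift_snd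
  pullback.lift_snd_assoc coprod.inl_desc coprod.inr_desc prod.lift_fst prod.lift_fst_assoc
  prod.lift_snd prod.lift_snd_assoc κ_σ ι_ρ κ_ρ ι_σ

variable {C : Type u} [Category.{v} C] [HasZeroMorphisms C] [SemiAbelian C]
variable {H G : CrossedModule C}

/-- The 2-cell out of a composite induced by a morphism out of the pullback which is compatible with
the four arrows. -/
noncomputable def homOfPullback {K : CrossedModule C} (E : Butterfly H G) (F : Butterfly G K)
    (D : Butterfly H K) (w : pullback E.ρ F.σ ⟶ D.obj) (hmid : mid E F ≫ w = 0)
    (hκ : pullback.lift E.κ 0 (by simp) ≫ w = D.κ) (hρ : w ≫ D.ρ = pullback.snd _ _ ≫ F.ρ)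
    (hι : pullback.lift 0 F.ι (by simp) ≫ w = D.ι) (hσ : w ≫ D.σ = pullback.fst _ _ ≫ E.σ) :
    comp E F ⟶ D where
  hom := desc E F w hmid
  κ_hom := by rw [comp_κ, pair, Category.assoc, proj_desc, hκ]
  hom_ρ := by rw [← cancel_epi (proj E F), proj_desc_assoc, proj_ρ, hρ]
  ι_hom := by rw [comp_ι, pair, Category.assoc, proj_desc, hι]
  hom_σ := by rw [← cancel_epi (proj E F), proj_desc_assoc, proj_σ, hσ]

/-- The diagonal and `⟨0, κ⟩` are a section and a kernel of the first projection of the kernel pair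
of `ρ`, hence jointly epimorphic by protomodularity. -/
lemma kernelPair_ext (E : Butterfly H G) (hE : E.IsFlippable) {Z : C}
    {f g : pullback E.ρ E.ρ ⟶ Z}
    (h₁ : pullback.lift (𝟙 E.obj) (𝟙 E.obj) rfl ≫ f = pullback.lift (𝟙 E.obj) (𝟙 E.obj) rfl ≫ g)
    (h₂ : pullback.lift (0 : H.top ⟶ E.obj) E.κ (by simp) ≫ f =
      pullback.lift (0 : H.top ⟶ E.obj) E.κ (by simp) ≫ g) : f = g :=
  point_ext (isKernel_pullback_fst E.ρ hE.1) (s := pullback.lift (𝟙 _) (𝟙 _) rfl) (by simp) f g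
    h₂ h₁

/-- The kernel pair of `ρ` is the semidirect product of `H` and `E`; the morphism constructed here
sends `(x, κ h · x)` to the arrow `g h · e (σ x)`. -/
lemma exists_kernelPair_desc (E : Butterfly H G) (hE : E.IsFlippable) :
    ∃ w : pullback E.ρ E.ρ ⟶ H.arr,
      pullback.lift (𝟙 E.obj) (𝟙 E.obj) rfl ≫ w = E.σ ≫ H.e ∧
      pullback.lift (0 : H.top ⟶ E.obj) E.κ (by simp) ≫ w = H.g := by
  refine point_desc (isKernel_pullback_fst E.ρ hE.1) (s := pullback.lift (𝟙 _) (𝟙 _) rfl)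
    (by simp) (flatMap E.σ (𝟙 _) ≫ H.action.act) ?_ _ _ ?_
  · have hκ := E.precrossed_κ
    rw [flatMap_conj_eq] at hκ
    have e₁ : coprod.desc (pullback.lift (𝟙 E.obj) (𝟙 E.obj) rfl)
        (pullback.lift (0 : H.top ⟶ E.obj) E.κ (by simp)) ≫ pullback.fst E.ρ E.ρ =
        coprod.desc (𝟙 _) 0 := by ext <;> simp
    have e₂ : coprod.desc (pullback.lift (𝟙 E.obj) (𝟙 E.obj) rfl)
        (pullback.lift (0 : H.top ⟶ E.obj) E.κ (by simp)) ≫ pullback.snd E.ρ E.ρ =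
        coprod.desc (𝟙 _) E.κ := by ext <;> simp
    apply pullback.hom_ext
    · simp [e₁]
    · simp [e₂, hκ]
  · rw [Category.assoc, ← H.flatι_e_g, flatMap_ι_assoc]
    congr 1
    ext <;> simp

/-- The canonical 2-cell from the composite of a flippable butterfly with its flip to the identity
butterfly. -/
lemma nonempty_hom_comp_flip [HuqSmith C] (E : Butterfly H G) (hE : E.IsFlippable) :
    Nonempty (comp E (E.flip hE) ⟶ id H) := by
  obtain ⟨w, hw₁, hw₂⟩ := exists_kernelPair_desc E hE
  have hdiag {T : C} (x : T ⟶ E.obj) : pullback.lift x x rfl ≫ w = x ≫ E.σ ≫ H.e := by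
    rw [← hw₁, ← Category.assoc]
    congr 1
    apply pullback.hom_ext <;> simp
  have hc : w ≫ H.c = pullback.fst _ _ ≫ E.σ := by
    apply kernelPair_ext E hE
    · rw [reassoc_of% hw₁]; simp
    · rw [reassoc_of% hw₂]; simp
  have hd : w ≫ H.d = pullback.snd _ _ ≫ E.σ := by
    apply kernelPair_ext E hE
    · rw [reassoc_of% hw₁]; simp
    · rw [reassoc_of% hw₂]; simp
  -- The division `(a, b) ↦ a b⁻¹` of the groupoid is `w` restricted to the pairs `(κ b, κ a)`.
  have hdiv : pullback.lift (prod.snd ≫ E.κ) (prod.fst ≫ E.κ) (by simp) ≫ w = H.division := by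
    apply CrossedModule.diag_ext
    · rw [H.inl_division, ← hw₂, ← Category.assoc]
      congr 1
      apply pullback.hom_ext <;> simp
    · have : pullback.lift E.κ E.κ rfl ≫ w = H.bd ≫ H.e := by
        rw [hdiag, reassoc_of% E.κ_σ]
      rw [H.diag_division, ← this, ← Category.assoc]
      congr 1
      apply pullback.hom_ext <;> simp
  have hκ : pullback.lift E.κ (0 : H.top ⟶ E.obj) (by simp) ≫ w = H.gInv := by
    rw [CrossedModule.gInv, ← hdiv, ← Category.assoc]
    congr 1
    apply pullback.hom_ext <;> simp
  have hmid : mid E (E.flip hE) ≫ w = 0 := by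
    have : mid E (E.flip hE) ≫ w = E.ι ≫ E.σ ≫ H.e := hdiag E.ι
    rw [this, ← Category.assoc, ι_σ, zero_comp]
  exact ⟨homOfPullback E (E.flip hE) (id H) w hmid hκ hd hw₂ hc⟩

end Butterfly
end SemiAb

theorem mainTheorem3 {C : Type u} [CategoryTheory.Category.{v} C]
    [CategoryTheory.Limits.HasZeroMorphisms C] [SemiAb.SemiAbelian C] [SemiAb.HuqSmith C]
    {H G : SemiAb.CrossedModule C} (E : SemiAb.Butterfly H G) (hE : E.IsFlippable) :
    ∃ e : CategoryTheory.Bicategory.Equivalence H G, e.hom = E ∧ e.inv = E.flip hE := by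
  obtain ⟨η⟩ := E.nonempty_hom_comp_flip hE
  -- The flip of `E` is flippable with flip `E`, since `(ι, σ)` is an extension.
  obtain ⟨ε⟩ : Nonempty (SemiAb.Butterfly.comp (E.flip hE) E ⟶ SemiAb.Butterfly.id G) :=
    (E.flip hE).nonempty_hom_comp_flip E.isExtension
  let counit := asIso ε
  exact ⟨Bicategory.Equivalence.mkOfAdjointifyCounit (f := (E : H ⟶ G))
    (g := (E.flip hE : G ⟶ H)) (asIso η).symm counit, rfl, rfl⟩
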